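/- Let $k$ be a field, $R=k[x,y,z]$ with the standard grading, $R_+=(x,y,z)$, and let $s\ge 3$ be an integer. For a homogeneous ideal $J\subsetneq R$ with $R/J$ Artinian, let $\mathfrak m$ be the maximal ideal of $R/J$, let $e=\dim_k\mathfrak m/\mathfrak m^2$ be its embedding dimension, let its (top) socle degree be the largest $t$ with $\mathfrak m^t\ne 0$, and put $c_\ell=\dim_k\big(\operatorname{Soc}(R/J)\cap\mathfrak m^\ell\big)/\big(\operatorname{Soc}(R/J)\cap\mathfrak m^{\ell+1}\big)$. Such a ring is called compressed if $$\dim_k \mathfrak m^i/\mathfrak m^{i+1}=\min\Big\{\binom{e-1+i}{i},\ \sum_{\ell=i}^{t}c_\ell\binom{e-1+\ell-i}{\ell-i}\Big\}\qquad (0\le i\le t).$$ Let $I\subset R$ be a homogeneous ideal of grade $3$ such that $R/I$ is an Artinian compressed ring of embedding dimension $3$ with $\operatorname{Soc}(R/I)\cong k(-s)\oplus k(-2s+1)$ as graded modules. Then: 1. There are homogeneous grade $3$ Gorenstein ideals $I_1,I_2$ with $I=I_1\cap I_2$ such that $R/I_1$ and $R/I_2$ have socle degrees $s$ and $2s-1$,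 respectively. 2. For every such decomposition $I=I_1\cap I_2$ there is a minimal generating set $(\phi_1,\dots,\phi_{s+1},\psi_1,\dots,\psi_b)$ of $I_2$, with all $\phi_i$ homogeneous of degree $s$ and all $\psi_j$ homogeneous of degree $s+1$, such that $$I=(\phi_1,\dots,\phi_s,\psi_1,\dots,\psi_b)+R_+\phi_{s+1},$$ where $b=\dim_k\operatorname{Tor}_1^R(R/I_2,k)_{s+1}=\dim_k\operatorname{Tor}_2^R(R/I_2,k)_{s+1}$. In particular every such ideal $I$ is a trimmed Gorenstein ideal. -/

import Mathlib

open MvPolynomial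

noncomputable section

namespace TrimmedGorenstein

/-- `dim_k U / (U ∩ V)` for subspaces `U`, `V` of a `k`-vector space. -/
def relDim {k M : Type*} [Field k] [AddCommGroup M] [Module k M] (U V : Submodule k M) : ℕ :=
  Module.finrank k (U ⧸ V.submoduleOf U)

/-- The grade of an ideal `I` of `R`: the supremum of the lengths of the `R`-sequences contained
in `I`. (For a proper ideal `I` a weakly regular sequence in `I` is automatically regular; the unit
ideal has infinite grade.) -/
def grade {R : Type*} [CommRing R] (I : Ideal R) : ℕ∞ :=
  ⨆ rs ∈ {rs : List R | (∀ r ∈ rs, r ∈ I) ∧ RingTheory.Sequence.IsWeaklyRegular R rs},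
    (rs.length : ℕ∞)

/-- The standard graded polynomial ring `k[x, y, z]`, with `x = X 0`, `y = X 1`, `z = X 2`. -/
abbrev Poly3 (k : Type*) [Field k] : Type _ := MvPolynomial (Fin 3) k

variable {k : Type*} [Field k]

attribute [local instance] MvPolynomial.gradedAlgebra

/-- `I` is homogeneous for the standard grading. -/
def IsHomog (I : Ideal (Poly3 k)) : Prop :=
  I.IsHomogeneous (homogeneousSubmodule (Fin 3) k)

/-- The irrelevant ideal `R_+ = (x, y, z)`. -/
def irrel (k : Type*) [Field k] : Ideal (Poly3 k) := idealOfVars (Fin 3) k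

/-- The image `𝔪` of `R_+` in `R / I`. -/
def maxIdeal (I : Ideal (Poly3 k)) : Ideal (Poly3 k ⧸ I) :=
  (irrel k).map (Ideal.Quotient.mk I)

/-- The socle `0 :_{R/I} 𝔪` of `R / I`. -/
def socle (I : Ideal (Poly3 k)) : Ideal (Poly3 k ⧸ I) :=
  (⊥ : Ideal (Poly3 k ⧸ I)).colon (maxIdeal I : Set (Poly3 k ⧸ I))

/-- The degree `n` component `(R / I)_n`, that is, the image of `R_n`. -/
def component (I : Ideal (Poly3 k)) (n : ℕ) : Submodule k (Poly3 k ⧸ I) :=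
  (homogeneousSubmodule (Fin 3) k n).map (Ideal.Quotient.mkₐ k I).toLinearMap

/-- `dim_k Soc(R / I)_n`. -/
def socleDim (I : Ideal (Poly3 k)) (n : ℕ) : ℕ :=
  Module.finrank k ↥((socle I).restrictScalars k ⊓ component I n)

/-- `dim_k 𝔪^i / 𝔪^(i+1)`. -/
def hilb (I : Ideal (Poly3 k)) (i : ℕ) : ℕ :=
  relDim ((maxIdeal I ^ i).restrictScalars k) ((maxIdeal I ^ (i + 1)).restrictScalars k)

/-- The embedding dimension `dim_k 𝔪 / 𝔪^2` of `R / I`. -/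
def embDim (I : Ideal (Poly3 k)) : ℕ := hilb I 1

/-- The coefficient `c_i = dim_k (Soc ∩ 𝔪^i) / (Soc ∩ 𝔪^(i+1))` of the socle polynomial. -/
def socleCoeff (I : Ideal (Poly3 k)) (i : ℕ) : ℕ :=
  relDim ((socle I ⊓ maxIdeal I ^ i).restrictScalars k)
    ((socle I ⊓ maxIdeal I ^ (i + 1)).restrictScalars k)

/-- `t` is the top socle degree of `R / I`: the largest `t` with `𝔪^t ≠ 0`. -/
def IsTopSocleDegree (I : Ideal (Poly3 k)) (t : ℕ) : Prop :=
  IsGreatest {n : ℕ | maxIdeal I ^ n ≠ ⊥} t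

/-- `R / I` is Artinian and compressed: with `e` its embedding dimension, `t` its top socle degree
and `∑ c_ℓ z^ℓ` its socle polynomial,
`dim_k 𝔪^i/𝔪^(i+1) = min {C(e-1+i, i), ∑_ℓ c_ℓ C(e-1+ℓ-i, ℓ-i)}` for `0 ≤ i ≤ t`.
The terms with `ℓ < i` vanish, so the sum runs over `i ≤ ℓ ≤ t`. -/
def IsCompressed (I : Ideal (Poly3 k)) : Prop :=
  Module.Finite k (Poly3 k ⧸ I) ∧
    ∃ t : ℕ, IsTopSocleDegree I t ∧
      ∀ i ≤ t, hilb I i =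
        min ((embDim I - 1 + i).choose i)
          (∑ l ∈ Finset.Icc i t, socleCoeff I l * (embDim I - 1 + (l - i)).choose (l - i))

/-- `I` is a homogeneous grade 3 Gorenstein ideal: `R / I` is an Artinian ring of type one. -/
def IsGorenstein3 (I : Ideal (Poly3 k)) : Prop :=
  IsHomog I ∧ grade I = 3 ∧ Module.Finite k (Poly3 k ⧸ I) ∧
    Module.finrank k ((socle I).restrictScalars k) = 1

/-- `I = I₁ ∩ I₂` with `I₁`, `I₂` homogeneous grade 3 Gorenstein ideals defining rings of socle
degrees `s₁` and `s₂`. -/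
def IsGorensteinDecomposition (s₁ s₂ : ℕ) (I I₁ I₂ : Ideal (Poly3 k)) : Prop :=
  I = I₁ ⊓ I₂ ∧ IsGorenstein3 I₁ ∧ IsTopSocleDegree I₁ s₁ ∧
    IsGorenstein3 I₂ ∧ IsTopSocleDegree I₂ s₂

/-- The family `g` is a minimal (that is, irredundant) generating set of `I`. -/
def IsMinimalGeneratingFamily {R ι : Type*} [CommRing R] (I : Ideal R) (g : ι → R) : Prop :=
  Ideal.span (Set.range g) = I ∧ ∀ i, Ideal.span (g '' {i}ᶜ) ≠ I

/-! The Koszul complex of `x, y, z` on `A = R / I`, written as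
`0 → A(-3) → A(-2)³ → A(-1)³ → A → 0` with the maps `a ↦ a • (x, y, z)`, `v ↦ (x, y, z) × v` and
`v ↦ (x, y, z) ⬝ v`. Its homology computes `Tor^R(A, k)` with the grading. -/

/-- The vector `(x, y, z)` over `R / I`. -/
def vars (I : Ideal (Poly3 k)) : Fin 3 → Poly3 k ⧸ I := fun i => Ideal.Quotient.mk I (X i)

/-- `A(-3) → A(-2)³`. -/
def koszul₃ (I : Ideal (Poly3 k)) : (Poly3 k ⧸ I) →ₗ[Poly3 k ⧸ I] (Fin 3 → Poly3 k ⧸ I) :=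
  LinearMap.toSpanSingleton _ _ (vars I)

/-- `A(-2)³ → A(-1)³`. -/
def koszul₂ (I : Ideal (Poly3 k)) :
    (Fin 3 → Poly3 k ⧸ I) →ₗ[Poly3 k ⧸ I] (Fin 3 → Poly3 k ⧸ I) :=
  crossProduct (vars I)

/-- `A(-1)³ → A`. -/
def koszul₁ (I : Ideal (Poly3 k)) : (Fin 3 → Poly3 k ⧸ I) →ₗ[Poly3 k ⧸ I] (Poly3 k ⧸ I) :=
  dotProductBilin (Poly3 k ⧸ I) (Poly3 k ⧸ I) (vars I)

/-- The vectors in `A³` all of whose entries lie in `A_n`. -/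
def component3 (I : Ideal (Poly3 k)) (n : ℕ) : Submodule k (Fin 3 → Poly3 k ⧸ I) :=
  Submodule.pi Set.univ fun _ => component I n

/-- `dim_k Tor_1^R(R / I, k)_(n+1)`, the homology at `A(-1)³` in degree `n + 1`
(entries of degree `n`). -/
def torDimOne (I : Ideal (Poly3 k)) (n : ℕ) : ℕ :=
  relDim ((LinearMap.ker (koszul₁ I)).restrictScalars k ⊓ component3 I n)
    ((LinearMap.range (koszul₂ I)).restrictScalars k ⊓ component3 I n)

/-- `dim_k Tor_2^R(R / I, k)_(n+2)`, the homology at `A(-2)³` in degree `n + 2`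
(entries of degree `n`). -/
def torDimTwo (I : Ideal (Poly3 k)) (n : ℕ) : ℕ :=
  relDim ((LinearMap.ker (koszul₂ I)).restrictScalars k ⊓ component3 I n)
    ((LinearMap.range (koszul₃ I)).restrictScalars k ⊓ component3 I n)

end TrimmedGorenstein

end

/-! The decomposition comes from Macaulay duality. For each of the two socle degrees, choose a
functional on `R` that lives in that degree, kills `I` and is nonzero on the socle generator. The
largest ideal in its kernel is Gorenstein (`IsSupportedInDegree.finrank_socle`). The two ideals meet
exactly in `I`, because anything outside `I` has a multiple that is a nonzero socle element, and one
of the two functionals detects it.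

For the second claim write `J = I₂`. Compressedness enters only through `dim I_s = s`
(`finrank_gradedPart_of_isCompressed`). The Hilbert function of `R/J` is symmetric about `(2s-1)/2`,
so `R/J` has equal dimensions in degrees `s-1` and `s`; hence `dim J_s ≥ s+1`, with equality only if
`J_(s-1) = 0`. Since `(I₁)_s` has codimension at most one in `R_s`, also `dim J_s ≤ s+1`. So `J`
starts in degree `s`, and `I_s` is a hyperplane in `J_s`. Above degree `s` the ideal `I₁` is
everything, and `I` and `J` agree.

The Koszul complex of `R/J` is self-dual, so `Tor_1` in degree `m+1` and `Tor_2` in degree `n+2`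
have equal dimension when `m + n = 2s-1` (`IsDualizing.torDimOne_eq_torDimTwo`). As `J_(s-1) = 0`,
this `Tor_2` vanishes for `m > s`, so `J` is generated in degrees `s` and `s+1`; the case `m = s`
equates the two expressions for `b`. A basis of `I_s`, one further element `φ_(s+1)` of `J_s`, and
lifts of a basis of `J_(s+1)/R_1 J_s` then form the required generators. -/

open MvPolynomial

noncomputable section

namespace TrimmedGorenstein

/-! ### Relative dimensions, orthogonal complements and bases modulo a subspace. -/

section LinearAlgebra

variable {k E M M' : Type*} [Field k] [AddCommGroup E] [Module k E] [AddCommGroup M] [Module k M]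
  [AddCommGroup M'] [Module k M']

theorem mem_submoduleOf {U V : Submodule k M} {x : U} : x ∈ V.submoduleOf U ↔ (x : M) ∈ V :=
  Iff.rfl

/-- Both quotients are images of the common source `K`, and the last hypothesis says that the two
surjections have the same kernel. This compares adic or homological quotients with graded ones. -/
theorem relDim_eq_of_maps {U V : Submodule k M} {U' V' : Submodule k M'} (K : Submodule k E)
    (f : E →ₗ[k] M) (g : E →ₗ[k] M') (hU : K.map f = U) (hU' : K.map g = U')
    (h : ∀ x ∈ K, f x ∈ V ↔ g x ∈ V') : relDim U V = relDim U' V' := by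
  have hf : ∀ x ∈ K, f x ∈ U := fun x hx => hU ▸ Submodule.mem_map_of_mem hx
  have hg : ∀ x ∈ K, g x ∈ U' := fun x hx => hU' ▸ Submodule.mem_map_of_mem hx
  let F : K →ₗ[k] U ⧸ V.submoduleOf U := (V.submoduleOf U).mkQ ∘ₗ f.restrict hf
  let G : K →ₗ[k] U' ⧸ V'.submoduleOf U' := (V'.submoduleOf U').mkQ ∘ₗ g.restrict hg
  have hF : Function.Surjective F := by
    refine (Submodule.mkQ_surjective _).comp ?_
    rintro ⟨u, hu⟩
    rw [← hU] at hu
    obtain ⟨x, hx, rfl⟩ := hu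
    exact ⟨⟨x, hx⟩, rfl⟩
  have hG : Function.Surjective G := by
    refine (Submodule.mkQ_surjective _).comp ?_
    rintro ⟨u, hu⟩
    rw [← hU'] at hu
    obtain ⟨x, hx, rfl⟩ := hu
    exact ⟨⟨x, hx⟩, rfl⟩
  have hker : LinearMap.ker F = LinearMap.ker G := by
    ext ⟨x, hx⟩
    simp only [F, G, LinearMap.mem_ker, LinearMap.comp_apply, Submodule.mkQ_apply,
      Submodule.Quotient.mk_eq_zero, mem_submoduleOf]
    exact h x hx
  rw [relDim, relDim, ← (F.quotKerEquivOfSurjective hF).finrank_eq,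
    ← (G.quotKerEquivOfSurjective hG).finrank_eq, hker]

theorem relDim_bot (U : Submodule k M) : relDim U ⊥ = Module.finrank k U := by
  have : (⊥ : Submodule k M).submoduleOf U = ⊥ := by
    ext x; simp [mem_submoduleOf]
  rw [relDim, this]
  exact (Submodule.quotEquivOfEqBot _ rfl).finrank_eq

theorem relDim_add_finrank (U V : Submodule k M) [FiniteDimensional k U] (h : V ≤ U) :
    relDim U V + Module.finrank k V = Module.finrank k U := by
  rw [relDim, ← (Submodule.submoduleOfEquivOfLe h).finrank_eq]
  exact Submodule.finrank_quotient_add_finrank _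

theorem relDim_eq_zero_of_le {U V : Submodule k M} (h : U ≤ V) : relDim U V = 0 := by
  have : V.submoduleOf U = ⊤ := by
    ext x; simpa [mem_submoduleOf] using h x.2
  rw [relDim, this]
  exact Module.finrank_zero_of_subsingleton

theorem le_of_relDim_eq_zero {U V : Submodule k M} [FiniteDimensional k U]
    (h : relDim U V = 0) : U ≤ V := by
  intro x hx
  have := Module.finrank_zero_iff.mp h
  have h0 : (V.submoduleOf U).mkQ ⟨x, hx⟩ = 0 := Subsingleton.elim _ _
  simpa [mem_submoduleOf] using h0

/-- Up to the isomorphism with the bidual, the flip is the transpose, so row rank equals column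
rank. -/
theorem finrank_range_flip [FiniteDimensional k M] [FiniteDimensional k M']
    (B : M →ₗ[k] M' →ₗ[k] k) :
    Module.finrank k (LinearMap.range B.flip) = Module.finrank k (LinearMap.range B) := by
  have h : B.flip = B.dualMap ∘ₗ Module.Dual.eval k M' := by ext; rfl
  rw [h, LinearMap.range_comp_of_range_eq_top,
    LinearMap.finrank_range_dualMap_eq_finrank_range]
  exact LinearMap.range_eq_top.mpr (Module.evalEquiv k M').surjective

/-- The dimension of an orthogonal complement. -/
theorem finrank_orthogonal (B : M →ₗ[k] M' →ₗ[k] k) (U : Submodule k M) (W X : Submodule k M')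
    [FiniteDimensional k U] [FiniteDimensional k W]
    (hU : ∀ u ∈ U, (∀ w ∈ W, B u w = 0) → u = 0)
    (hX : ∀ w, w ∈ X ↔ w ∈ W ∧ ∀ u ∈ U, B u w = 0) :
    Module.finrank k X + Module.finrank k U = Module.finrank k W := by
  let C : U →ₗ[k] W →ₗ[k] k := B.domRestrict₁₂ U W
  have hinj : Function.Injective C := by
    rw [← LinearMap.ker_eq_bot, LinearMap.ker_eq_bot']
    rintro ⟨u, hu⟩ h
    exact Subtype.ext (hU u hu fun w hw => LinearMap.congr_fun h ⟨w, hw⟩)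
  have hker : LinearMap.ker C.flip = X.submoduleOf W := by
    ext ⟨w, hw⟩
    rw [mem_submoduleOf, LinearMap.mem_ker, LinearMap.ext_iff]
    constructor
    · intro h
      exact (hX w).2 ⟨hw, fun u hu => h ⟨u, hu⟩⟩
    · rintro h ⟨u, hu⟩
      exact ((hX w).1 h).2 u hu
  have h1 := LinearMap.finrank_range_add_finrank_ker C.flip
  have hXW : X ≤ W := fun w hw => ((hX w).1 hw).1
  rw [finrank_range_flip, LinearMap.finrank_range_of_inj hinj, hker,
    (Submodule.submoduleOfEquivOfLe hXW).finrank_eq] at h1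
  omega

theorem exists_generator_of_finrank_eq_one {U : Submodule k M} (h : Module.finrank k U = 1) :
    ∃ σ ∈ U, σ ≠ 0 ∧ ∀ w ∈ U, ∃ c : k, c • σ = w := by
  obtain ⟨⟨σ, hσ⟩, hσ0, hspan⟩ := finrank_eq_one_iff'.1 h
  refine ⟨σ, hσ, fun h => hσ0 (Subtype.ext h), fun w hw => ?_⟩
  obtain ⟨c, hc⟩ := hspan ⟨w, hw⟩
  exact ⟨c, congrArg Subtype.val hc⟩

/-- Lifts of a basis of `U / (U ∩ V)`. -/
theorem exists_basis_mod (U V : Submodule k M) [FiniteDimensional k U] :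
    ∃ ψ : Fin (relDim U V) → M, (∀ j, ψ j ∈ U) ∧ U ≤ V ⊔ Submodule.span k (Set.range ψ) ∧
      ∀ j, ψ j ∉ V ⊔ Submodule.span k (ψ '' {j}ᶜ) := by
  let e : Module.Basis (Fin (relDim U V)) k (U ⧸ V.submoduleOf U) := Module.finBasis k _
  choose ψ hψ using fun j => Submodule.mkQ_surjective (V.submoduleOf U) (e j)
  refine ⟨fun j => ψ j, fun j => (ψ j).2, fun u hu => ?_, fun j hj => ?_⟩
  · have h := e.sum_repr ((V.submoduleOf U).mkQ ⟨u, hu⟩)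
    simp_rw [← hψ, ← map_smul, ← map_sum] at h
    have h' := (Submodule.Quotient.eq _).1 h
    rw [mem_submoduleOf] at h'
    have hs : (∑ i, e.repr ((V.submoduleOf U).mkQ ⟨u, hu⟩) i • ψ i : U).1 ∈
        Submodule.span k (Set.range fun j => (ψ j : M)) := by
      rw [Submodule.coe_sum]
      exact sum_mem fun i _ => Submodule.smul_mem _ _ (Submodule.subset_span ⟨i, rfl⟩)
    have := Submodule.sub_mem _ (Submodule.mem_sup_right (S := V) hs)
      (Submodule.mem_sup_left (T := Submodule.span k (Set.range fun j => (ψ j : M))) h')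
    simpa using this
  · obtain ⟨v, hv, w, hw, hvw⟩ := Submodule.mem_sup.1 hj
    have himg : (fun j => (ψ j : M)) '' {j}ᶜ = U.subtype '' (ψ '' {j}ᶜ) := by
      rw [Set.image_image]; rfl
    rw [himg, ← Submodule.map_span] at hw
    obtain ⟨w', hw', rfl⟩ := hw
    have h1 : (V.submoduleOf U).mkQ (ψ j) = (V.submoduleOf U).mkQ w' := by
      refine (Submodule.Quotient.eq _).2 ?_
      rw [mem_submoduleOf, Submodule.coe_sub, show (ψ j : M) = v + w' from hvw.symm,
        add_sub_cancel_right]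
      exact hv
    have h2 := Submodule.mem_map_of_mem (f := (V.submoduleOf U).mkQ) hw'
    rw [Submodule.map_span, Set.image_image, ← h1, hψ] at h2
    simp_rw [hψ] at h2
    exact e.linearIndependent.notMem_span_image (s := {j}ᶜ) (by simp) h2

end LinearAlgebra

/-! ### The bound on the grade by the Krull dimension. -/

section Grade

open RingTheory.Sequence

/-- A regular element avoids the minimal primes of the support, so each entry of the sequence lowers
the dimension of the support by at least one. -/
theorem length_le_supportDim {R : Type*} [CommRing R] [IsNoetherianRing R] (rs : List R) :
    ∀ (M : Type _) [AddCommGroup M] [Module R M] [Module.Finite R M], IsRegular M rs →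
      (rs.length : WithBot ℕ∞) ≤ Module.supportDim R M := by
  induction rs with
  | nil =>
    intro M _ _ _ h
    have : Nontrivial M := by
      by_contra hM
      rw [not_nontrivial_iff_subsingleton] at hM
      exact h.top_ne_smul (Subsingleton.elim _ _)
    have h0 := Module.supportDim_ne_bot_of_nontrivial R M
    obtain ⟨d, hd⟩ := WithBot.ne_bot_iff_exists.mp h0
    rw [← hd]
    exact WithBot.coe_le_coe.mpr bot_le
  | cons r rs ih =>
    intro M _ _ _ h
    rw [isRegular_cons_iff] at h
    have h1 := ih _ h.2
    have h2 := Module.supportDim_quotSMulTop_succ_le_of_notMem_minimalPrimes (R := R) (M := M)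
      (x := r) (fun _ => h.1.notMem_of_mem_minimalPrimes)
    refine le_trans ?_ h2
    push_cast [List.length_cons]
    gcongr

theorem grade_mono {R : Type*} [CommRing R] {I J : Ideal R} (h : I ≤ J) : grade I ≤ grade J :=
  biSup_mono fun _ hrs => ⟨fun r hr => h (hrs.1 r hr), hrs.2⟩

theorem grade_le_three {k : Type*} [Field k] {I : Ideal (Poly3 k)} (hI : I ≠ ⊤) :
    grade I ≤ 3 := by
  refine iSup₂_le fun rs hrs => ?_
  have hreg : IsRegular (Poly3 k) rs := by
    refine ⟨hrs.2, fun h => hI ?_⟩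
    rw [smul_eq_mul, Ideal.mul_top] at h
    rw [eq_top_iff, h]
    exact Ideal.span_le.mpr hrs.1
  have h := length_le_supportDim rs _ hreg
  rw [Module.supportDim_self_eq_ringKrullDim, MvPolynomial.ringKrullDim_of_isNoetherianRing,
    ringKrullDim_eq_zero_of_field, zero_add, Nat.card_fin] at h
  exact_mod_cast h

end Grade

variable {k : Type*} [Field k]

attribute [local instance] MvPolynomial.gradedAlgebra

/-! ### Homogeneous components and powers of the irrelevant ideal. -/

section Polynomials

theorem coe_decompose_eq (p : Poly3 k) (n : ℕ) :
    (DirectSum.decompose (homogeneousSubmodule (Fin 3) k) p n : Poly3 k) =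
      homogeneousComponent n p :=
  decomposition.decompose'_apply p n

theorem homogeneousComponent_add_mul {j : ℕ} {g : Poly3 k} (hg : g.IsHomogeneous j) (q : Poly3 k)
    (i : ℕ) : homogeneousComponent (i + j) (q * g) = homogeneousComponent i q * g := by
  have := DirectSum.coe_decompose_mul_add_of_right_mem (homogeneousSubmodule (Fin 3) k) (a := q)
    (b := g) (i := i) (j := j) hg
  rwa [coe_decompose_eq, coe_decompose_eq] at this

theorem homogeneousComponent_mul_of_lt {j n : ℕ} {g : Poly3 k} (hg : g.IsHomogeneous j)
    (q : Poly3 k) (h : n < j) : homogeneousComponent n (q * g) = 0 := by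
  have := DirectSum.coe_decompose_mul_of_right_mem_of_not_le (homogeneousSubmodule (Fin 3) k)
    (a := q) (b := g) (i := j) (n := n) hg (not_le.mpr h)
  rwa [coe_decompose_eq] at this

theorem homogeneous_induction {P : Poly3 k → Prop}
    (hom : ∀ n p, p.IsHomogeneous n → P p) (add : ∀ p q, P p → P q → P (p + q)) (p : Poly3 k) :
    P p := by
  rw [← sum_homogeneousComponent p]
  exact Finset.sum_induction _ P add (hom 0 0 (isHomogeneous_zero _ _ _))
    fun i _ => hom i _ (homogeneousComponent_isHomogeneous i p)

instance finiteDimensional_homogeneousSubmodule (n : ℕ) :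
    FiniteDimensional k (homogeneousSubmodule (Fin 3) k n) :=
  Module.Finite.iff_fg.mpr (homogeneousSubmodule_fg _ _ n)

theorem finrank_homogeneousSubmodule (n : ℕ) :
    Module.finrank k (homogeneousSubmodule (Fin 3) k n) = (2 + n).choose n := by
  have e : homogeneousSubmodule (Fin 3) k n = restrictSupport k {d : Fin 3 →₀ ℕ | d.degree = n} :=
    homogeneousSubmodule_eq_finsupp_supported _ _ n
  have hs : {d : Fin 3 →₀ ℕ | d.degree = n} =
      ↑((Finset.univ : Finset (Fin 3)).finsuppAntidiag n) := by
    ext d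
    simp [Finset.mem_finsuppAntidiag, Finsupp.degree_eq_sum]
  rw [e, Module.finrank_eq_nat_card_basis (basisRestrictSupport k _), hs, Nat.card_coe_set_eq,
    Set.ncard_coe_finset, Finset.card_finsuppAntidiag_nat_eq_choose]
  simp only [Finset.card_univ, Fintype.card_fin]
  congr 1
  omega

theorem mem_irrel_pow_iff {n : ℕ} {p : Poly3 k} :
    p ∈ irrel k ^ n ↔ ∀ i < n, homogeneousComponent i p = 0 := by
  rw [irrel, mem_pow_idealOfVars_iff']
  constructor
  · intro h i hi
    ext d
    rw [coeff_homogeneousComponent]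
    split_ifs with hd
    · simpa using h d (by omega)
    · simp
  · intro h d hd
    have := congrArg (coeff d) (h _ hd)
    simpa [coeff_homogeneousComponent] using this

theorem mem_irrel_pow_of_isHomogeneous {m n : ℕ} {p : Poly3 k} (hp : p.IsHomogeneous n)
    (h : m ≤ n) : p ∈ irrel k ^ m := by
  rw [mem_irrel_pow_iff]
  intro i hi
  rw [homogeneousComponent_of_mem hp, if_neg (by omega)]

theorem homogeneousComponent_self {n : ℕ} {p : Poly3 k} (hp : p.IsHomogeneous n) :
    homogeneousComponent n p = p := by
  rw [homogeneousComponent_of_mem hp, if_pos rfl]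

theorem X_mem_irrel (i : Fin 3) : (X i : Poly3 k) ∈ irrel k :=
  Ideal.subset_span ⟨i, rfl⟩

theorem sub_homogeneousComponent_mem {n : ℕ} {p : Poly3 k} (hp : p ∈ irrel k ^ n) :
    p - homogeneousComponent n p ∈ irrel k ^ (n + 1) := by
  rw [mem_irrel_pow_iff] at hp ⊢
  intro i hi
  rw [map_sub, homogeneousComponent_of_mem (homogeneousComponent_isHomogeneous n p)]
  split_ifs with h
  · rw [h, sub_self]
  · rw [hp i (by omega), sub_zero]

theorem sub_C_mem_irrel (p : Poly3 k) : p - C (coeff 0 p) ∈ irrel k := by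
  have := sub_homogeneousComponent_mem (n := 0) (p := p) (by simp)
  simpa using this

theorem mem_of_homogeneousComponent_mem {I : Ideal (Poly3 k)} {p : Poly3 k}
    (h : ∀ n, homogeneousComponent n p ∈ I) : p ∈ I := by
  rw [← sum_homogeneousComponent p]
  exact sum_mem fun i _ => h i

theorem isHomog_of_homogeneousComponent_mem {I : Ideal (Poly3 k)}
    (h : ∀ p ∈ I, ∀ n, homogeneousComponent n p ∈ I) : IsHomog I :=
  fun n p hp => (coe_decompose_eq p n).symm ▸ h p hp n

theorem IsHomog.homogeneousComponent_mem {I : Ideal (Poly3 k)} (h : IsHomog I) {p : Poly3 k}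
    (hp : p ∈ I) (n : ℕ) : homogeneousComponent n p ∈ I :=
  homogeneousComponent_mem_of_mem h hp n

/-- A linear form is a combination of the variables. -/
theorem IsHomogeneous.exists_sum_X {n : ℕ} {p : Poly3 k} (hp : p.IsHomogeneous (n + 1)) :
    ∃ q : Fin 3 → Poly3 k, (∀ i, (q i).IsHomogeneous n) ∧ p = ∑ i, X i * q i := by
  have h : p ∈ irrel k := by simpa using mem_irrel_pow_of_isHomogeneous (m := 1) hp (by omega)
  rw [irrel, idealOfVars, Ideal.mem_span_range_iff_exists_fun] at h
  obtain ⟨c, hc⟩ := h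
  refine ⟨fun i => homogeneousComponent n (c i), fun i => homogeneousComponent_isHomogeneous n _, ?_⟩
  rw [← homogeneousComponent_self hp, ← hc, map_sum]
  refine Finset.sum_congr rfl fun i _ => ?_
  rw [homogeneousComponent_add_mul (isHomogeneous_X k i), mul_comm]

end Polynomials

/-! ### Adic invariants of `R/I` computed degree by degree. -/

section Quotient

variable {I : Ideal (Poly3 k)}

theorem mem_component {n : ℕ} {a : Poly3 k ⧸ I} :
    a ∈ component I n ↔ ∃ p : Poly3 k, p.IsHomogeneous n ∧ Ideal.Quotient.mk I p = a :=
  Iff.rfl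

theorem mk_mem_component {n : ℕ} {p : Poly3 k} (hp : p.IsHomogeneous n) :
    Ideal.Quotient.mk I p ∈ component I n :=
  ⟨p, hp, rfl⟩

theorem mul_mem_component {m n : ℕ} {a b : Poly3 k ⧸ I} (ha : a ∈ component I m)
    (hb : b ∈ component I n) : a * b ∈ component I (m + n) := by
  obtain ⟨p, hp, rfl⟩ := mem_component.1 ha
  obtain ⟨q, hq, rfl⟩ := mem_component.1 hb
  rw [← map_mul]
  exact mk_mem_component (hp.mul hq)

theorem vars_mem_component (i : Fin 3) : vars I i ∈ component I 1 :=
  mk_mem_component (isHomogeneous_X k i)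

theorem component_induction {P : Poly3 k ⧸ I → Prop}
    (hom : ∀ n, ∀ a ∈ component I n, P a) (add : ∀ a b, P a → P b → P (a + b))
    (a : Poly3 k ⧸ I) : P a := by
  obtain ⟨p, rfl⟩ := Ideal.Quotient.mk_surjective a
  refine homogeneous_induction (P := fun p => P (Ideal.Quotient.mk I p))
    (fun n p hp => hom n _ (mk_mem_component hp)) (fun p q hp hq => ?_) p
  rw [map_add]
  exact add _ _ hp hq

theorem finrank_component_add (n : ℕ) :
    Module.finrank k (component I n) +
      Module.finrank k ↥(I.restrictScalars k ⊓ homogeneousSubmodule (Fin 3) k n) =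
    Module.finrank k (homogeneousSubmodule (Fin 3) k n) := by
  let f := (Ideal.Quotient.mkₐ k I).toLinearMap.domRestrict (homogeneousSubmodule (Fin 3) k n)
  have hr : LinearMap.range f = component I n := by
    rw [LinearMap.range_domRestrict]; rfl
  have hk : LinearMap.ker f = (I.restrictScalars k ⊓ homogeneousSubmodule (Fin 3) k n).submoduleOf
      (homogeneousSubmodule (Fin 3) k n) := by
    ext ⟨p, hp⟩
    rw [mem_submoduleOf]
    simp only [f, LinearMap.mem_ker, LinearMap.domRestrict_apply, AlgHom.toLinearMap_apply,
      Ideal.Quotient.mkₐ_eq_mk, Ideal.Quotient.eq_zero_iff_mem, Submodule.mem_inf,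
      Submodule.restrictScalars_mem]
    exact ⟨fun h => ⟨h, hp⟩, fun h => h.1⟩
  rw [← LinearMap.finrank_range_add_finrank_ker f, hr, hk,
    (Submodule.submoduleOfEquivOfLe inf_le_right).finrank_eq]

theorem mem_maxIdeal_pow {n : ℕ} {a : Poly3 k ⧸ I} :
    a ∈ maxIdeal I ^ n ↔ ∃ p ∈ irrel k ^ n, Ideal.Quotient.mk I p = a := by
  rw [maxIdeal, ← Ideal.map_pow]
  exact Ideal.mem_map_iff_of_surjective _ Ideal.Quotient.mk_surjective

theorem mem_socle {a : Poly3 k ⧸ I} : a ∈ socle I ↔ ∀ i, a * vars I i = 0 := by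
  rw [socle, Submodule.mem_colon]
  constructor
  · intro h i
    simpa using h (vars I i) (Ideal.mem_map_of_mem _ (X_mem_irrel i))
  · intro h b hb
    have : maxIdeal I ≤ (⊥ : Ideal (Poly3 k ⧸ I)).colon {a} := by
      rw [maxIdeal, irrel, idealOfVars, Ideal.map_span, Ideal.span_le]
      rintro _ ⟨_, ⟨i, rfl⟩, rfl⟩
      have := h i
      simp only [SetLike.mem_coe, Submodule.mem_colon_singleton, Submodule.mem_bot, smul_eq_mul]
      rw [mul_comm]; exact this
    have := this hb
    simp only [Submodule.mem_colon_singleton, Submodule.mem_bot, smul_eq_mul] at this ⊢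
    rw [mul_comm]; exact this

theorem mk_mem_socle {p : Poly3 k} : Ideal.Quotient.mk I p ∈ socle I ↔ ∀ i, p * X i ∈ I := by
  rw [mem_socle]
  refine forall_congr' fun i => ?_
  rw [vars, ← map_mul, Ideal.Quotient.eq_zero_iff_mem]

theorem IsHomog.homogeneousComponent_mem_socle (hI : IsHomog I) {p : Poly3 k}
    (hp : Ideal.Quotient.mk I p ∈ socle I) (n : ℕ) :
    Ideal.Quotient.mk I (homogeneousComponent n p) ∈ socle I := by
  rw [mk_mem_socle] at hp ⊢
  intro i
  rw [← homogeneousComponent_add_mul (isHomogeneous_X k i)]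
  exact hI.homogeneousComponent_mem (hp i) _

/-- For homogeneous `I`, the class in `𝔪^n/𝔪^(n+1)` depends only on the degree `n` component. This
turns the local definitions of `hilb` and `socleCoeff` into graded ones. -/
theorem IsHomog.mk_mem_maxIdeal_pow (hI : IsHomog I) {n : ℕ} {p : Poly3 k}
    (hp : p ∈ irrel k ^ n) :
    Ideal.Quotient.mk I p ∈ maxIdeal I ^ (n + 1) ↔ homogeneousComponent n p ∈ I := by
  rw [mem_maxIdeal_pow]
  constructor
  · rintro ⟨q, hq, h⟩
    rw [Ideal.Quotient.eq] at h
    have := hI.homogeneousComponent_mem h n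
    rw [map_sub, mem_irrel_pow_iff.1 hq n (by omega), zero_sub] at this
    exact neg_mem_iff.1 this
  · intro h
    refine ⟨_, sub_homogeneousComponent_mem hp, ?_⟩
    rw [map_sub, Ideal.Quotient.eq_zero_iff_mem.2 h, sub_zero]

theorem IsHomog.hilb_eq (hI : IsHomog I) (n : ℕ) :
    hilb I n = Module.finrank k (component I n) := by
  rw [hilb, ← relDim_bot]
  refine relDim_eq_of_maps ((irrel k ^ n).restrictScalars k) (Ideal.Quotient.mkₐ k I).toLinearMap
    ((Ideal.Quotient.mkₐ k I).toLinearMap ∘ₗ homogeneousComponent n) ?_ ?_ ?_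
  · ext a
    exact mem_maxIdeal_pow.symm
  · ext a
    constructor
    · rintro ⟨p, -, rfl⟩
      exact mk_mem_component (homogeneousComponent_isHomogeneous n p)
    · rintro ⟨p, hp, rfl⟩
      refine ⟨p, mem_irrel_pow_of_isHomogeneous hp le_rfl, ?_⟩
      simp only [LinearMap.comp_apply, homogeneousComponent_self hp]
  · intro p hp
    exact (hI.mk_mem_maxIdeal_pow hp).trans Ideal.Quotient.eq_zero_iff_mem.symm

theorem IsHomog.socleCoeff_eq (hI : IsHomog I) (n : ℕ) : socleCoeff I n = socleDim I n := by
  rw [socleCoeff, socleDim, ← relDim_bot]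
  refine relDim_eq_of_maps ((irrel k ^ n).restrictScalars k ⊓
      ((socle I).restrictScalars k).comap (Ideal.Quotient.mkₐ k I).toLinearMap)
    (Ideal.Quotient.mkₐ k I).toLinearMap
    ((Ideal.Quotient.mkₐ k I).toLinearMap ∘ₗ homogeneousComponent n) ?_ ?_ ?_
  · ext a
    constructor
    · rintro ⟨p, ⟨hp, hs⟩, rfl⟩
      exact ⟨hs, mem_maxIdeal_pow.2 ⟨p, hp, rfl⟩⟩
    · rintro ⟨hs, hm⟩
      obtain ⟨p, hp, rfl⟩ := mem_maxIdeal_pow.1 hm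
      exact ⟨p, ⟨hp, hs⟩, rfl⟩
  · ext a
    constructor
    · rintro ⟨p, ⟨-, hs⟩, rfl⟩
      exact ⟨hI.homogeneousComponent_mem_socle hs n,
        mk_mem_component (homogeneousComponent_isHomogeneous n p)⟩
    · rintro ⟨hs, ⟨p, hp, rfl⟩⟩
      refine ⟨p, ⟨mem_irrel_pow_of_isHomogeneous hp le_rfl, hs⟩, ?_⟩
      simp only [LinearMap.comp_apply, homogeneousComponent_self hp]
  · rintro p ⟨hp, hs⟩
    refine Iff.trans ?_
      ((hI.mk_mem_maxIdeal_pow hp).trans Ideal.Quotient.eq_zero_iff_mem.symm)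
    exact ⟨fun h => h.2, fun h => ⟨hs, h⟩⟩

theorem maxIdeal_pow_eq_bot_iff {n : ℕ} : maxIdeal I ^ n = ⊥ ↔ irrel k ^ n ≤ I := by
  rw [maxIdeal, ← Ideal.map_pow, Ideal.map_eq_bot_iff_le_ker, Ideal.mk_ker]

theorem IsTopSocleDegree.irrel_pow_le {t : ℕ} (h : IsTopSocleDegree I t) :
    irrel k ^ (t + 1) ≤ I := by
  rw [← maxIdeal_pow_eq_bot_iff]
  by_contra hne
  have := h.2 hne
  omega

theorem IsTopSocleDegree.mem_of_isHomogeneous {t n : ℕ} (h : IsTopSocleDegree I t) (hn : t < n)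
    {p : Poly3 k} (hp : p.IsHomogeneous n) : p ∈ I :=
  h.irrel_pow_le (mem_irrel_pow_of_isHomogeneous hp hn)

theorem IsTopSocleDegree.exists_isHomogeneous {t : ℕ} (h : IsTopSocleDegree I t) :
    ∃ p : Poly3 k, p.IsHomogeneous t ∧ p ∉ I := by
  have h1 : ¬ irrel k ^ t ≤ I := fun h' => h.1 (maxIdeal_pow_eq_bot_iff.2 h')
  obtain ⟨p, hp, hpI⟩ := SetLike.not_le_iff_exists.1 h1
  refine ⟨_, homogeneousComponent_isHomogeneous t p, fun h' => hpI ?_⟩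
  have := I.add_mem (h.irrel_pow_le (sub_homogeneousComponent_mem hp)) h'
  rwa [sub_add_cancel] at this

/-- If the maximal ideal is nilpotent, every nonzero element has a nonzero multiple in the
socle. -/
theorem exists_mul_mem_socle {n : ℕ} (hn : irrel k ^ n ≤ I) {p : Poly3 k} (hp : p ∉ I) :
    ∃ q, p * q ∉ I ∧ Ideal.Quotient.mk I (p * q) ∈ socle I := by
  by_contra! hcon
  -- A multiple that is not in the socle survives multiplication by some variable; repeating this
  -- contradicts nilpotency.
  have key : ∀ m, ∃ q ∈ irrel k ^ m, p * q ∉ I := by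
    intro m
    induction m with
    | zero => exact ⟨1, by simp, by simpa using hp⟩
    | succ m ih =>
      obtain ⟨q, hq, hpq⟩ := ih
      have := hcon q hpq
      rw [mk_mem_socle] at this
      push Not at this
      obtain ⟨i, hi⟩ := this
      exact ⟨q * X i, by rw [pow_succ]; exact Ideal.mul_mem_mul hq (X_mem_irrel i),
        by rwa [← mul_assoc]⟩
  obtain ⟨q, hq, hpq⟩ := key n
  exact hpq (I.mul_mem_left _ (hn hq))

end Quotient

/-! ### Exactness of the Koszul complex over the polynomial ring. -/

section KoszulExact

theorem X_dvd_of_dvd_X_mul {i j : Fin 3} (hij : i ≠ j) {p : Poly3 k}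
    (h : (X i : Poly3 k) ∣ X j * p) : (X i : Poly3 k) ∣ p := by
  rw [X_dvd_mul_iff, X_dvd_X] at h
  exact h.resolve_left hij

/-- `z` is a nonzerodivisor modulo the monomial ideal `(x, y)`: multiplying a monomial by `z` does
not change its exponents of `x` and `y`. -/
theorem exists_eq_X_mul_add_X_mul {p : Poly3 k}
    (h : (X 2 : Poly3 k) * p ∈ Ideal.span {X 0, X 1}) : ∃ a b, p = X 0 * a + X 1 * b := by
  have hs : (X '' {0, 1} : Set (Poly3 k)) = {X 0, X 1} := by simp [Set.image_pair]
  have hp : p ∈ Ideal.span (X '' {0, 1} : Set (Poly3 k)) := by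
    rw [← hs] at h
    rw [mem_ideal_span_X_image] at h ⊢
    intro m hm
    obtain ⟨i, hi, hmi⟩ := h (Finsupp.single 2 1 + m) (by
      rw [mem_support_iff, coeff_X_mul]; exact mem_support_iff.mp hm)
    refine ⟨i, hi, ?_⟩
    rcases hi with rfl | rfl <;> simpa using hmi
  rw [hs, Ideal.mem_span_pair] at hp
  obtain ⟨a, b, rfl⟩ := hp
  exact ⟨a, b, by ring⟩

theorem exists_cross_of_dot_eq_zero {u : Fin 3 → Poly3 k} (h : ∑ i, X i * u i = 0) :
    ∃ v : Fin 3 → Poly3 k, crossProduct (X : Fin 3 → Poly3 k) v = u := by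
  rw [Fin.sum_univ_three] at h
  obtain ⟨a, b, hab⟩ : ∃ a b, u 2 = X 0 * a + X 1 * b := by
    apply exists_eq_X_mul_add_X_mul
    rw [Ideal.mem_span_pair]
    exact ⟨-u 0, -u 1, by linear_combination -h⟩
  have h1 : X 0 * (u 0 + X 2 * a) + X 1 * (u 1 + X 2 * b) = 0 := by
    rw [hab] at h
    linear_combination h
  obtain ⟨c, hc⟩ : (X 0 : Poly3 k) ∣ u 1 + X 2 * b :=
    X_dvd_of_dvd_X_mul (j := 1) (by decide) ⟨-(u 0 + X 2 * a), by linear_combination h1⟩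
  have h2 : u 0 + X 2 * a = - (X 1 * c) := by
    apply mul_left_cancel₀ (X_ne_zero (R := k) (0 : Fin 3))
    rw [hc] at h1
    linear_combination h1
  -- Read off from `u 2 = xa + yb`, `u 1 + zb = xc` and `u 0 + za = -yc`.
  refine ⟨![-b, a, -c], ?_⟩
  rw [cross_apply]
  ext1 i
  fin_cases i
  · simp; linear_combination -h2
  · simp; linear_combination -hc
  · simp; linear_combination -hab

theorem exists_smul_of_cross_eq_zero {u : Fin 3 → Poly3 k}
    (h : crossProduct (X : Fin 3 → Poly3 k) u = 0) : ∃ a : Poly3 k, ∀ i, u i = a * X i := by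
  rw [cross_apply] at h
  have h0 := congrFun h 0
  have h1 := congrFun h 1
  have h2 := congrFun h 2
  simp at h0 h1 h2
  obtain ⟨a, ha⟩ : (X 0 : Poly3 k) ∣ u 0 :=
    X_dvd_of_dvd_X_mul (j := 1) (by decide) ⟨u 1, by linear_combination -h2⟩
  have hx := X_ne_zero (R := k) (0 : Fin 3)
  have e1 : u 1 = X 1 * a := by
    apply mul_left_cancel₀ hx
    rw [ha] at h2
    linear_combination h2
  have e2 : u 2 = X 2 * a := by
    apply mul_left_cancel₀ hx
    rw [ha] at h1
    linear_combination -h1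
  refine ⟨a, fun i => ?_⟩
  fin_cases i
  · simpa [mul_comm] using ha
  · simpa [mul_comm] using e1
  · simpa [mul_comm] using e2

end KoszulExact

/-! ### Koszul homology of `R/I` in terms of the graded pieces of `I`. -/

section Tor

variable {I : Ideal (Poly3 k)}

/-- The degree `n` part of the ideal `I`. -/
def gradedPart (I : Ideal (Poly3 k)) (n : ℕ) : Submodule k (Poly3 k) :=
  I.restrictScalars k ⊓ homogeneousSubmodule (Fin 3) k n

instance finiteDimensional_gradedPart (n : ℕ) : FiniteDimensional k (gradedPart I n) :=
  Submodule.finiteDimensional_of_le inf_le_right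

/-- The map `u ↦ (x, y, z) ⬝ u`. -/
def varsDot (k : Type*) [Field k] : (Fin 3 → Poly3 k) →ₗ[k] Poly3 k :=
  ∑ i, LinearMap.mulLeft k (X i) ∘ₗ LinearMap.proj i

theorem varsDot_apply (u : Fin 3 → Poly3 k) : varsDot k u = ∑ i, X i * u i := by
  simp [varsDot]

/-- The subspace `R_1 I_n` of `I_(n+1)`. -/
def varsMul (I : Ideal (Poly3 k)) (n : ℕ) : Submodule k (Poly3 k) :=
  (Submodule.pi Set.univ fun _ => gradedPart I n).map (varsDot k)

theorem mem_varsMul {n : ℕ} {p : Poly3 k} :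
    p ∈ varsMul I n ↔ ∃ u : Fin 3 → Poly3 k, (∀ i, u i ∈ gradedPart I n) ∧ ∑ i, X i * u i = p := by
  simp [varsMul, Submodule.mem_map, Submodule.mem_pi, varsDot_apply]

theorem varsMul_le (n : ℕ) : varsMul I n ≤ gradedPart I (n + 1) := by
  intro p hp
  obtain ⟨u, hu, rfl⟩ := mem_varsMul.1 hp
  refine sum_mem fun i _ => ⟨I.mul_mem_left _ (hu i).1, ?_⟩
  rw [add_comm]
  exact (isHomogeneous_X k i).mul (hu i).2

theorem mem_component3 {n : ℕ} {u : Fin 3 → Poly3 k ⧸ I} :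
    u ∈ component3 I n ↔ ∀ i, u i ∈ component I n := by
  simp [component3, Submodule.mem_pi]

theorem koszul₁_apply (u : Fin 3 → Poly3 k ⧸ I) : koszul₁ I u = ∑ i, vars I i * u i := rfl

theorem koszul₂_apply (u : Fin 3 → Poly3 k ⧸ I) : koszul₂ I u = crossProduct (vars I) u := rfl

theorem koszul₃_apply (a : Poly3 k ⧸ I) (i : Fin 3) : koszul₃ I a i = a * vars I i := rfl

theorem koszul₁_mk (u : Fin 3 → Poly3 k) :
    koszul₁ I (fun i => Ideal.Quotient.mk I (u i)) = Ideal.Quotient.mk I (∑ i, X i * u i) := by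
  rw [koszul₁_apply, map_sum]
  simp only [vars, map_mul]

theorem koszul₂_mk (u : Fin 3 → Poly3 k) :
    koszul₂ I (fun i => Ideal.Quotient.mk I (u i)) =
      fun i => Ideal.Quotient.mk I (crossProduct (X : Fin 3 → Poly3 k) u i) := by
  rw [koszul₂_apply, cross_apply, cross_apply]
  ext1 i
  fin_cases i <;> simp [vars]

theorem exists_lift (u : Fin 3 → Poly3 k ⧸ I) :
    ∃ v : Fin 3 → Poly3 k, (fun i => Ideal.Quotient.mk I (v i)) = u := by
  choose v hv using fun i => Ideal.Quotient.mk_surjective (u i)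
  exact ⟨v, funext hv⟩

theorem exists_lift_of_mem_component3 {n : ℕ} {u : Fin 3 → Poly3 k ⧸ I}
    (hu : u ∈ component3 I n) :
    ∃ v : Fin 3 → Poly3 k, (∀ i, (v i).IsHomogeneous n) ∧
      (fun i => Ideal.Quotient.mk I (v i)) = u := by
  rw [mem_component3] at hu
  choose v hv hv' using fun i => mem_component.1 (hu i)
  exact ⟨v, hv, funext hv'⟩

theorem isHomogeneous_sum_X_mul {n : ℕ} {u : Fin 3 → Poly3 k} (hu : ∀ i, (u i).IsHomogeneous n) :
    (∑ i, X i * u i).IsHomogeneous (n + 1) := by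
  refine IsHomogeneous.sum _ _ _ fun i _ => ?_
  rw [add_comm]
  exact (isHomogeneous_X k i).mul (hu i)

theorem dot_cross_X (v : Fin 3 → Poly3 k) :
    ∑ i, X i * crossProduct (X : Fin 3 → Poly3 k) v i = 0 :=
  dot_self_cross _ v

/-- `Tor_1(R / I, k)` in degree `n + 1` is `I_(n+1) / R_1 I_n`. -/
theorem IsHomog.torDimOne_eq (hI : IsHomog I) (n : ℕ) :
    torDimOne I n = relDim (gradedPart I (n + 1)) (varsMul I n) := by
  rw [torDimOne]
  -- The common source consists of the degree `n` vectors over `R` whose dot product with `(x, y,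
  -- z)` lies in `I`: they reduce to Koszul cycles, and the dot product sends them onto `I_(n+1)`.
  refine relDim_eq_of_maps ((Submodule.pi Set.univ fun _ => homogeneousSubmodule (Fin 3) k n) ⊓
      (I.restrictScalars k).comap (varsDot k))
    ((Ideal.Quotient.mkₐ k I).toLinearMap.compLeft (Fin 3)) (varsDot k) ?_ ?_ ?_
  · ext a
    constructor
    · rintro ⟨u, ⟨hu, hu'⟩, rfl⟩
      have hu := Submodule.mem_pi.1 hu
      refine ⟨?_, mem_component3.2 fun i => mk_mem_component (hu i trivial)⟩
      refine LinearMap.mem_ker.2 ((koszul₁_mk u).trans ?_)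
      rw [Ideal.Quotient.eq_zero_iff_mem, ← varsDot_apply]
      exact hu'
    · rintro ⟨ha, ha'⟩
      obtain ⟨u, hu, rfl⟩ := exists_lift_of_mem_component3 ha'
      refine ⟨u, ⟨Submodule.mem_pi.2 fun i _ => hu i, ?_⟩, rfl⟩
      have := (koszul₁_mk u).symm.trans ha
      rw [Ideal.Quotient.eq_zero_iff_mem, ← varsDot_apply] at this
      exact this
  · ext p
    constructor
    · rintro ⟨u, ⟨hu, hu'⟩, rfl⟩
      have hu := Submodule.mem_pi.1 hu
      refine ⟨hu', ?_⟩
      rw [varsDot_apply]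
      exact isHomogeneous_sum_X_mul fun i => hu i trivial
    · rintro ⟨hp, hp'⟩
      obtain ⟨q, hq, rfl⟩ := IsHomogeneous.exists_sum_X hp'
      rw [← varsDot_apply] at hp ⊢
      exact ⟨q, ⟨Submodule.mem_pi.2 fun i _ => hq i, hp⟩, rfl⟩
  · rintro u ⟨hu, hu'⟩
    have hu := fun i => Submodule.mem_pi.1 hu i trivial
    rw [mem_varsMul, varsDot_apply]
    constructor
    · rintro ⟨⟨v, hv⟩, -⟩
      obtain ⟨v, rfl⟩ := exists_lift v
      rw [koszul₂_mk] at hv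
      -- Subtracting the boundary moves the entries into `I` without changing the dot product. The
      -- lift `v` need not be homogeneous, hence the truncation to degree `n`.
      refine ⟨fun i => homogeneousComponent n (u i - crossProduct (X : Fin 3 → Poly3 k) v i),
        fun i => ⟨?_, homogeneousComponent_isHomogeneous n _⟩, ?_⟩
      · refine hI.homogeneousComponent_mem (Ideal.Quotient.eq.1 ?_) n
        exact (congrFun hv i).symm
      · have h1 : ∑ i, X i * (u i - crossProduct (X : Fin 3 → Poly3 k) v i) = ∑ i, X i * u i := by
          simp only [mul_sub, Finset.sum_sub_distrib]
          rw [dot_cross_X, sub_zero]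
        rw [← homogeneousComponent_self (isHomogeneous_sum_X_mul hu), ← h1, map_sum]
        refine Finset.sum_congr rfl fun i _ => ?_
        rw [mul_comm (X i), mul_comm (X i), homogeneousComponent_add_mul (isHomogeneous_X k i)]
    · rintro ⟨w, hw, hwu⟩
      have h1 : ∑ i, X i * (u i - w i) = 0 := by
        simp only [mul_sub, Finset.sum_sub_distrib]
        rw [hwu, sub_self]
      obtain ⟨v, hv⟩ := exists_cross_of_dot_eq_zero h1
      refine ⟨⟨fun i => Ideal.Quotient.mk I (v i), ?_⟩,
        mem_component3.2 fun i => mk_mem_component (hu i)⟩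
      rw [koszul₂_mk, hv]
      ext1 i
      rw [map_sub, Ideal.Quotient.eq_zero_iff_mem.2 (hw i).1, sub_zero]
      rfl

theorem isHomogeneous_cross {n : ℕ} {u : Fin 3 → Poly3 k} (hu : ∀ i, (u i).IsHomogeneous n)
    (i : Fin 3) : (crossProduct (X : Fin 3 → Poly3 k) u i).IsHomogeneous (n + 1) := by
  have h : ∀ i j, (X i * u j).IsHomogeneous (n + 1) := fun i j => by
    rw [add_comm]
    exact (isHomogeneous_X k i).mul (hu j)
  rw [cross_apply]
  fin_cases i <;> exact (h _ _).sub (h _ _)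

/-- `Tor_2(R / I, k)` vanishes in degree `n + 2` if `I` has no elements of degree `n + 1`. -/
theorem torDimTwo_eq_zero {n : ℕ} (h : gradedPart I (n + 1) = ⊥) : torDimTwo I n = 0 := by
  refine relDim_eq_zero_of_le ?_
  rintro a ⟨ha, ha'⟩
  refine ⟨?_, ha'⟩
  obtain ⟨u, hu, rfl⟩ := exists_lift_of_mem_component3 ha'
  have h0 := (koszul₂_mk u).symm.trans ha
  -- The entries of this product lie in `I_(n+1) = 0`, so the cycle already lifts to a cycle over
  -- `R`, where the complex is exact.
  have h1 : crossProduct (X : Fin 3 → Poly3 k) u = 0 := by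
    ext1 i
    have hi : crossProduct (X : Fin 3 → Poly3 k) u i ∈ gradedPart I (n + 1) :=
      ⟨Ideal.Quotient.eq_zero_iff_mem.1 (congrFun h0 i), isHomogeneous_cross hu i⟩
    rw [h] at hi
    exact hi
  obtain ⟨b, hb⟩ := exists_smul_of_cross_eq_zero h1
  refine ⟨Ideal.Quotient.mk I b, ?_⟩
  ext1 i
  rw [koszul₃_apply, hb, map_mul, vars]

end Tor

/-! ### The Gorenstein pairing and self-duality of the Koszul complex. -/

section Duality

variable {I : Ideal (Poly3 k)} {N : ℕ} {f : (Poly3 k ⧸ I) →ₗ[k] k}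

/-- The functional `f` on `R / I` is homogeneous of degree `N` and `(a, b) ↦ f (a b)` is
nondegenerate. -/
structure IsDualizing (I : Ideal (Poly3 k)) (N : ℕ) (f : (Poly3 k ⧸ I) →ₗ[k] k) : Prop where
  apply_eq_zero : ∀ j ≠ N, ∀ a ∈ component I j, f a = 0
  eq_zero : ∀ a, (∀ b, f (a * b) = 0) → a = 0

theorem exists_apply_mk_eq (F : Poly3 k →ₗ[k] k) (hF : ∀ p ∈ I, F p = 0) :
    ∃ f : (Poly3 k ⧸ I) →ₗ[k] k, ∀ p, f (Ideal.Quotient.mk I p) = F p := by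
  obtain ⟨s, hs⟩ := LinearMap.exists_rightInverse_of_surjective
    (Ideal.Quotient.mkₐ k I).toLinearMap
    (LinearMap.range_eq_top.mpr Ideal.Quotient.mk_surjective)
  refine ⟨F ∘ₗ s, fun p => ?_⟩
  have h := LinearMap.congr_fun hs (Ideal.Quotient.mk I p)
  have h1 : s (Ideal.Quotient.mk I p) - p ∈ I := Ideal.Quotient.eq.1 h
  have h2 := hF _ h1
  rw [map_sub, sub_eq_zero] at h2
  exact h2

theorem apply_ne_zero_of_smul_eq {c : k} {a σ : Poly3 k ⧸ I} (h : c • σ = a) {g : (Poly3 k ⧸ I) →ₗ[k] k}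
    (hg : g σ ≠ 0) (ha : a ≠ 0) : g a ≠ 0 := by
  subst h
  rw [map_smul, smul_eq_mul]
  exact mul_ne_zero (fun hc => ha (by rw [hc, zero_smul])) hg

/-- Take the degree `N` component followed by a functional that is nonzero on the socle generator
`σ`. Every nonzero element has a nonzero socle multiple, and that is a nonzero scalar times `σ`. -/
theorem exists_isDualizing (hI : IsGorenstein3 I) (hN : IsTopSocleDegree I N) :
    ∃ f, IsDualizing I N f := by
  obtain ⟨hhom, -, -, hsoc⟩ := hI
  obtain ⟨p, hp, hpI⟩ := hN.exists_isHomogeneous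
  set σ := Ideal.Quotient.mk I p with hσ
  have hσ0 : σ ≠ 0 := fun h => hpI (Ideal.Quotient.eq_zero_iff_mem.1 h)
  have hσs : σ ∈ socle I := mk_mem_socle.2 fun i =>
    hN.mem_of_isHomogeneous (Nat.lt_succ_self N) (hp.mul (isHomogeneous_X k i))
  have hspan := (finrank_eq_one_iff_of_nonzero' (⟨σ, hσs⟩ : (socle I).restrictScalars k)
    (fun h => hσ0 (congrArg Subtype.val h))).1 hsoc
  obtain ⟨g, hg⟩ : ∃ g : (Poly3 k ⧸ I) →ₗ[k] k, g σ ≠ 0 := by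
    by_contra! h
    exact hσ0 ((Module.forall_dual_apply_eq_zero_iff k σ).1 h)
  obtain ⟨f, hf⟩ := exists_apply_mk_eq (I := I)
    (g ∘ₗ (Ideal.Quotient.mkₐ k I).toLinearMap ∘ₗ homogeneousComponent N) (fun q hq => by
      have : Ideal.Quotient.mk I (homogeneousComponent N q) = 0 :=
        Ideal.Quotient.eq_zero_iff_mem.2 (hhom.homogeneousComponent_mem hq N)
      simp [this])
  have hfσ : f σ ≠ 0 := by
    have := hf p
    simp only [LinearMap.comp_apply, homogeneousComponent_self hp] at this
    rw [this]
    exact hg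
  refine ⟨f, fun j hj a ha => ?_, fun a ha => ?_⟩
  · obtain ⟨q, hq, rfl⟩ := mem_component.1 ha
    rw [hf]
    simp [homogeneousComponent_of_mem hq, hj.symm]
  · obtain ⟨q, rfl⟩ := Ideal.Quotient.mk_surjective a
    by_contra h
    rw [Ideal.Quotient.eq_zero_iff_mem] at h
    obtain ⟨r, hr, hrs⟩ := exists_mul_mem_socle hN.irrel_pow_le h
    obtain ⟨c, hc⟩ := hspan ⟨_, hrs⟩
    have hne := apply_ne_zero_of_smul_eq (congrArg Subtype.val hc) hfσ
      (fun h => hr (Ideal.Quotient.eq_zero_iff_mem.1 h))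
    have h0 := ha (Ideal.Quotient.mk I r)
    rw [← map_mul] at h0
    exact hne h0

theorem IsDualizing.eq_zero_of_mem_component (hf : IsDualizing I N f) {m n : ℕ} (h : m + n = N)
    {a : Poly3 k ⧸ I} (ha : a ∈ component I m) (hab : ∀ b ∈ component I n, f (a * b) = 0) :
    a = 0 := by
  refine hf.eq_zero a (component_induction (fun j b hb => ?_) fun b c hb hc => ?_)
  · by_cases hj : j = n
    · exact hab b (hj ▸ hb)
    · exact hf.apply_eq_zero (m + j) (by omega) _ (mul_mem_component ha hb)
  · rw [mul_add, map_add, hb, hc, add_zero]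

/-- Symmetry of the Hilbert function: components of complementary degrees are in perfect pairing. -/
theorem IsDualizing.finrank_component_eq [FiniteDimensional k (Poly3 k ⧸ I)] (hf : IsDualizing I N f) {m n : ℕ} (h : m + n = N) :
    Module.finrank k (component I m) = Module.finrank k (component I n) := by
  have := finrank_orthogonal ((LinearMap.mul k (Poly3 k ⧸ I)).compr₂ f) (component I m)
    (component I n) ⊥ (fun u hu hw => hf.eq_zero_of_mem_component h hu hw) (fun w => by
      rw [Submodule.mem_bot]
      constructor
      · rintro rfl
        exact ⟨zero_mem _, fun u _ => by simp⟩
      · rintro ⟨hw, hu⟩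
        refine hf.eq_zero_of_mem_component (add_comm m n ▸ h) hw fun b hb => ?_
        rw [mul_comm]
        exact hu b hb)
  simpa using this

/-- The pairing `(u, v) ↦ f (u ⬝ v)` on `(R / I)³`. -/
def dotPairing (f : (Poly3 k ⧸ I) →ₗ[k] k) :
    (Fin 3 → Poly3 k ⧸ I) →ₗ[k] (Fin 3 → Poly3 k ⧸ I) →ₗ[k] k :=
  ∑ i, ((LinearMap.mul k (Poly3 k ⧸ I)).compr₂ f).compl₁₂ (LinearMap.proj i) (LinearMap.proj i)

theorem dotPairing_apply (u v : Fin 3 → Poly3 k ⧸ I) :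
    dotPairing f u v = f (∑ i, u i * v i) := by
  simp [dotPairing, LinearMap.sum_apply]

theorem IsDualizing.eq_zero_of_mem_component3 (hf : IsDualizing I N f) {m n : ℕ} (h : m + n = N)
    {u : Fin 3 → Poly3 k ⧸ I} (hu : u ∈ component3 I m)
    (huv : ∀ v ∈ component3 I n, dotPairing f u v = 0) : u = 0 := by
  ext1 i
  refine hf.eq_zero_of_mem_component h (mem_component3.1 hu i) fun b hb => ?_
  have := huv (Pi.single i b) (mem_component3.2 fun j => by
    by_cases hj : j = i
    · subst hj; simpa using hb
    · simp [hj])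
  rw [dotPairing_apply] at this
  simpa [Pi.single_apply] using this

/-- Under the dot pairing `koszul₁` is the transpose of `koszul₃`, so the kernel of one is the
orthogonal complement of the image of the other. -/
theorem IsDualizing.mem_ker_koszul₁_iff (hf : IsDualizing I N f) {m n : ℕ} (h : m + n = N)
    (w : Fin 3 → Poly3 k ⧸ I) :
    w ∈ (LinearMap.ker (koszul₁ I)).restrictScalars k ⊓ component3 I n ↔ w ∈ component3 I n ∧
      ∀ u ∈ (LinearMap.range (koszul₃ I)).restrictScalars k ⊓ component3 I m,
        dotPairing f u w = 0 := by
  have key : ∀ a, ∑ i, koszul₃ I a i * w i = koszul₁ I w * a := fun a => by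
    rw [koszul₁_apply, Finset.sum_mul]
    exact Finset.sum_congr rfl fun i _ => by rw [koszul₃_apply]; ring
  constructor
  · rintro ⟨hw, hw'⟩
    refine ⟨hw', ?_⟩
    rintro _ ⟨⟨a, rfl⟩, -⟩
    rw [dotPairing_apply, key, LinearMap.mem_ker.1 hw, zero_mul, map_zero]
  · rintro ⟨hw, hu⟩
    refine ⟨LinearMap.mem_ker.2 (hf.eq_zero _ (component_induction (fun j b hb => ?_)
      fun b c hb hc => ?_)), hw⟩
    · have hm : koszul₃ I b ∈ component3 I (j + 1) := mem_component3.2 fun i =>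
        mul_mem_component hb (vars_mem_component i)
      rw [← key, ← dotPairing_apply]
      by_cases hj : j + 1 = m
      · exact hu _ ⟨⟨b, rfl⟩, hj ▸ hm⟩
      · rw [dotPairing_apply]
        exact hf.apply_eq_zero (j + 1 + n) (by omega) _ (sum_mem fun i _ =>
          mul_mem_component (mem_component3.1 hm i) (mem_component3.1 hw i))
    · rw [mul_add, map_add, hb, hc, add_zero]

/-- The cross product with a fixed vector is skew, so `koszul₂` is minus its own transpose. -/
theorem IsDualizing.mem_ker_koszul₂_iff (hf : IsDualizing I N f) {m n : ℕ} (h : m + n = N)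
    (w : Fin 3 → Poly3 k ⧸ I) :
    w ∈ (LinearMap.ker (koszul₂ I)).restrictScalars k ⊓ component3 I n ↔ w ∈ component3 I n ∧
      ∀ u ∈ (LinearMap.range (koszul₂ I)).restrictScalars k ⊓ component3 I m,
        dotPairing f u w = 0 := by
  have key : ∀ a, ∑ i, koszul₂ I a i * w i = - ∑ i, koszul₂ I w i * a i := fun a => by
    rw [koszul₂_apply, koszul₂_apply, cross_apply, cross_apply]
    simp [Fin.sum_univ_three]
    ring
  constructor
  · rintro ⟨hw, hw'⟩
    refine ⟨hw', ?_⟩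
    rintro _ ⟨⟨a, rfl⟩, -⟩
    rw [dotPairing_apply, key, LinearMap.mem_ker.1 hw]
    simp
  · rintro ⟨hw, hu⟩
    refine ⟨LinearMap.mem_ker.2 (funext fun i => hf.eq_zero _ (component_induction
      (fun j b hb => ?_) fun b c hb hc => ?_)), hw⟩
    · have hb' : Pi.single i b ∈ component3 I j := mem_component3.2 fun i' => by
        by_cases hi : i' = i
        · subst hi; simpa using hb
        · simp [hi]
      have hm : koszul₂ I (Pi.single i b) ∈ component3 I (j + 1) := by
        obtain ⟨v, hv, hv'⟩ := exists_lift_of_mem_component3 hb'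
        rw [← hv', koszul₂_mk]
        exact mem_component3.2 fun i => mk_mem_component (isHomogeneous_cross hv i)
      have key' : koszul₂ I w i * b = - ∑ l, koszul₂ I (Pi.single i b) l * w l := by
        rw [key, neg_neg]
        simp [Pi.single_apply]
      rw [key', map_neg, neg_eq_zero]
      by_cases hj : j + 1 = m
      · rw [← dotPairing_apply]
        exact hu _ ⟨⟨_, rfl⟩, hj ▸ hm⟩
      · exact hf.apply_eq_zero (j + 1 + n) (by omega) _ (sum_mem fun i _ =>
          mul_mem_component (mem_component3.1 hm i) (mem_component3.1 hw i))
    · rw [mul_add, map_add, hb, hc, add_zero]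

theorem range_koszul₂_le_ker_koszul₁ :
    LinearMap.range (koszul₂ I) ≤ LinearMap.ker (koszul₁ I) := by
  rintro _ ⟨a, rfl⟩
  exact dot_self_cross _ a

theorem range_koszul₃_le_ker_koszul₂ :
    LinearMap.range (koszul₃ I) ≤ LinearMap.ker (koszul₂ I) := by
  rintro _ ⟨a, rfl⟩
  rw [LinearMap.mem_ker, koszul₂_apply, koszul₃, LinearMap.toSpanSingleton_apply, map_smul,
    cross_self, smul_zero]

/-- Duality between `Tor_1` and `Tor_2`. -/
theorem IsDualizing.torDimOne_eq_torDimTwo [FiniteDimensional k (Poly3 k ⧸ I)] (hf : IsDualizing I N f) {m n : ℕ} (h : m + n = N) :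
    torDimOne I m = torDimTwo I n := by
  have h' : n + m = N := by omega
  have h1 := finrank_orthogonal (dotPairing f)
    ((LinearMap.range (koszul₃ I)).restrictScalars k ⊓ component3 I n) _ _
    (fun u hu => hf.eq_zero_of_mem_component3 h' hu.2) (hf.mem_ker_koszul₁_iff h')
  have h2 := finrank_orthogonal (dotPairing f)
    ((LinearMap.range (koszul₂ I)).restrictScalars k ⊓ component3 I m) _ _
    (fun u hu => hf.eq_zero_of_mem_component3 h hu.2) (hf.mem_ker_koszul₂_iff h)
  have h3 := relDim_add_finrank
    ((LinearMap.ker (koszul₁ I)).restrictScalars k ⊓ component3 I m)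
    ((LinearMap.range (koszul₂ I)).restrictScalars k ⊓ component3 I m)
    (inf_le_inf_right _ range_koszul₂_le_ker_koszul₁)
  have h4 := relDim_add_finrank
    ((LinearMap.ker (koszul₂ I)).restrictScalars k ⊓ component3 I n)
    ((LinearMap.range (koszul₃ I)).restrictScalars k ⊓ component3 I n)
    (inf_le_inf_right _ range_koszul₃_le_ker_koszul₂)
  have h5 : Module.finrank k (component3 I m) = Module.finrank k (component3 I n) := by
    have := finrank_orthogonal (dotPairing f) (component3 I m) (component3 I n) ⊥
      (fun u hu hw => hf.eq_zero_of_mem_component3 h hu hw) (fun w => by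
      rw [Submodule.mem_bot]
      constructor
      · rintro rfl
        exact ⟨zero_mem _, fun u _ => by simp⟩
      · rintro ⟨hw, hu⟩
        refine hf.eq_zero_of_mem_component3 h' hw fun b hb => ?_
        rw [dotPairing_apply]
        simp_rw [mul_comm (w _)]
        rw [← dotPairing_apply]
        exact hu b hb)
    simpa using this
  -- Both sides equal `dim A³_m - dim (im koszul₃)_n - dim (im koszul₂)_m`, where `A = R/I` and `dim
  -- A³_m = dim A³_n`.
  rw [torDimOne, torDimTwo]
  omega

end Duality

/-! ### Gorenstein ideals defined by homogeneous functionals. -/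

section InverseSystem

/-- The largest ideal contained in the kernel of the functional `F`. -/
def annIdeal (F : Poly3 k →ₗ[k] k) : Ideal (Poly3 k) where
  carrier := {p | ∀ q, F (p * q) = 0}
  add_mem' hp hq r := by rw [add_mul, map_add, hp r, hq r, add_zero]
  zero_mem' r := by rw [zero_mul, map_zero]
  smul_mem' c p hp r := by rw [smul_eq_mul, mul_comm c, mul_assoc, hp]

variable {F : Poly3 k →ₗ[k] k} {N : ℕ}

theorem mem_annIdeal {p : Poly3 k} : p ∈ annIdeal F ↔ ∀ q, F (p * q) = 0 := Iff.rfl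

theorem apply_eq_zero_of_mem_annIdeal {p : Poly3 k} (hp : p ∈ annIdeal F) : F p = 0 := by
  simpa using hp 1

/-- The functional `F` on `R` vanishes outside degree `N`. -/
def IsSupportedInDegree (F : Poly3 k →ₗ[k] k) (N : ℕ) : Prop :=
  ∀ j ≠ N, ∀ p : Poly3 k, p.IsHomogeneous j → F p = 0

theorem IsSupportedInDegree.apply_eq (hF : IsSupportedInDegree F N) (p : Poly3 k) :
    F p = F (homogeneousComponent N p) := by
  refine homogeneous_induction (P := fun p => F p = F (homogeneousComponent N p))
    (fun n p hp => ?_) (fun p q hp hq => by rw [map_add, map_add, map_add, hp, hq]) p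
  rw [homogeneousComponent_of_mem hp]
  split_ifs with h
  · rfl
  · rw [map_zero]
    exact hF n (Ne.symm h) p hp

theorem IsSupportedInDegree.irrel_pow_le (hF : IsSupportedInDegree F N) :
    irrel k ^ (N + 1) ≤ annIdeal F := by
  intro p hp q
  rw [hF.apply_eq, mem_irrel_pow_iff.1 (Ideal.mul_mem_right q _ hp) N (Nat.lt_succ_self N), map_zero]

theorem IsSupportedInDegree.isHomog (hF : IsSupportedInDegree F N) : IsHomog (annIdeal F) := by
  refine isHomog_of_homogeneousComponent_mem fun p hp n => ?_
  rw [mem_annIdeal]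
  refine homogeneous_induction (fun j q hq => ?_) fun q r hq hr => by
    rw [mul_add, map_add, hq, hr, add_zero]
  by_cases h : n + j = N
  · rw [← homogeneousComponent_add_mul hq, h, ← hF.apply_eq]
    exact hp q
  · exact hF _ h _ ((homogeneousComponent_isHomogeneous n p).mul hq)

theorem annIdeal_ne_top (hF0 : F ≠ 0) : annIdeal F ≠ ⊤ := by
  intro h
  refine hF0 (LinearMap.ext fun p => ?_)
  exact apply_eq_zero_of_mem_annIdeal (by rw [h]; trivial)

theorem IsSupportedInDegree.isTopSocleDegree (hF : IsSupportedInDegree F N) (hF0 : F ≠ 0) :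
    IsTopSocleDegree (annIdeal F) N := by
  constructor
  · intro h
    rw [maxIdeal_pow_eq_bot_iff] at h
    refine hF0 (LinearMap.ext fun p => ?_)
    rw [hF.apply_eq]
    exact apply_eq_zero_of_mem_annIdeal (h (mem_irrel_pow_of_isHomogeneous
      (homogeneousComponent_isHomogeneous N p) le_rfl))
  · intro n hn
    by_contra! h
    exact hn (maxIdeal_pow_eq_bot_iff.2 ((Ideal.pow_le_pow_right h).trans hF.irrel_pow_le))

/-- `F` embeds the socle into `k`: if `p` represents a socle element, then `p * q` agrees with `q(0)
p` modulo the ideal, so `F p = 0` forces `p` into it. The socle is nonzero because `1` has a nonzero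
multiple there. -/
theorem IsSupportedInDegree.finrank_socle (hF : IsSupportedInDegree F N) (hF0 : F ≠ 0) :
    Module.finrank k ((socle (annIdeal F)).restrictScalars k) = 1 := by
  obtain ⟨f, hf⟩ := exists_apply_mk_eq (I := annIdeal F) F
    fun p hp => apply_eq_zero_of_mem_annIdeal hp
  have hinj : ∀ a ∈ socle (annIdeal F), f a = 0 → a = 0 := by
    intro a ha h0
    obtain ⟨p, rfl⟩ := Ideal.Quotient.mk_surjective a
    rw [hf] at h0
    rw [Ideal.Quotient.eq_zero_iff_mem]
    intro q
    have hpq : p * (q - C (coeff 0 q)) ∈ annIdeal F := by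
      have : irrel k ≤ (annIdeal F).colon {p} := by
        rw [irrel, idealOfVars, Ideal.span_le]
        rintro _ ⟨i, rfl⟩
        simp only [SetLike.mem_coe, Submodule.mem_colon_singleton, smul_eq_mul]
        rw [mul_comm]
        exact mk_mem_socle.1 ha i
      have := this (sub_C_mem_irrel q)
      simp only [Submodule.mem_colon_singleton, smul_eq_mul] at this
      rwa [mul_comm]
    have h1 := apply_eq_zero_of_mem_annIdeal hpq
    rw [mul_sub, map_sub, mul_comm p (C _), ← smul_eq_C_mul, map_smul, h0, smul_zero,
      sub_zero] at h1
    exact h1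
  obtain ⟨q, hq, hqs⟩ := exists_mul_mem_socle hF.irrel_pow_le
    (p := 1) (fun h => annIdeal_ne_top hF0 ((Ideal.eq_top_iff_one _).2 h))
  have hq0 : Ideal.Quotient.mk (annIdeal F) (1 * q) ≠ 0 :=
    fun h => hq (Ideal.Quotient.eq_zero_iff_mem.1 h)
  let g : ((socle (annIdeal F)).restrictScalars k) →ₗ[k] k := f.domRestrict _
  have hginj : Function.Injective g := by
    rw [← LinearMap.ker_eq_bot, LinearMap.ker_eq_bot']
    rintro ⟨a, ha⟩ h
    exact Subtype.ext (hinj a ha h)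
  have hle := LinearMap.finrank_le_finrank_of_injective hginj
  have : FiniteDimensional k ((socle (annIdeal F)).restrictScalars k) :=
    FiniteDimensional.of_injective g hginj
  have : Nontrivial ((socle (annIdeal F)).restrictScalars k) :=
    ⟨⟨⟨_, hqs⟩, 0, fun h => hq0 (congrArg Subtype.val h)⟩⟩
  have hpos := Module.finrank_pos (R := k) (M := (socle (annIdeal F)).restrictScalars k)
  rw [Module.finrank_self] at hle
  omega

theorem IsSupportedInDegree.isGorenstein3 (hF : IsSupportedInDegree F N) (hF0 : F ≠ 0)
    {I : Ideal (Poly3 k)} (hI : I ≤ annIdeal F) (hgrade : grade I = 3)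
    [FiniteDimensional k (Poly3 k ⧸ I)] : IsGorenstein3 (annIdeal F) := by
  refine ⟨hF.isHomog, le_antisymm (grade_le_three (annIdeal_ne_top hF0))
    (hgrade ▸ grade_mono hI), ?_, hF.finrank_socle hF0⟩
  exact Module.Finite.of_surjective (Ideal.Quotient.factorₐ k hI).toLinearMap
    (Ideal.Quotient.factor_surjective hI)

end InverseSystem

/-! ### Existence of the Gorenstein decomposition. -/

section Decomposition

variable {I : Ideal (Poly3 k)}

theorem exists_socle_functional (hI : IsHomog I) {n : ℕ} (h : socleDim I n = 1) :
    ∃ F : Poly3 k →ₗ[k] k, IsSupportedInDegree F n ∧ F ≠ 0 ∧ I ≤ annIdeal F ∧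
      ∀ p : Poly3 k, p.IsHomogeneous n → Ideal.Quotient.mk I p ∈ socle I → p ∈ annIdeal F →
        p ∈ I := by
  obtain ⟨σ, ⟨hσs, hσc⟩, hσ0, hspan⟩ := exists_generator_of_finrank_eq_one h
  obtain ⟨p₀, hp₀, rfl⟩ := mem_component.1 hσc
  have hσ : Ideal.Quotient.mk I p₀ ≠ 0 := hσ0
  obtain ⟨g, hg⟩ : ∃ g : (Poly3 k ⧸ I) →ₗ[k] k, g (Ideal.Quotient.mk I p₀) ≠ 0 := by
    by_contra! h
    exact hσ ((Module.forall_dual_apply_eq_zero_iff k _).1 h)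
  let F := g ∘ₗ (Ideal.Quotient.mkₐ k I).toLinearMap ∘ₗ homogeneousComponent n
  have hF : ∀ p, F p = g (Ideal.Quotient.mk I (homogeneousComponent n p)) := fun p => rfl
  refine ⟨F, fun j hj p hp => ?_, fun h => hg ?_, fun p hp q => ?_, fun p hp hps hpF => ?_⟩
  · rw [hF, homogeneousComponent_of_mem hp, if_neg hj.symm, map_zero, map_zero]
  · have := hF p₀
    rw [homogeneousComponent_self hp₀, h] at this
    exact this.symm
  · rw [hF, Ideal.Quotient.eq_zero_iff_mem.2
      (hI.homogeneousComponent_mem (I.mul_mem_right q hp) n), map_zero]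
  · by_contra hpI
    have hpI' : Ideal.Quotient.mk I p ≠ 0 := fun h => hpI (Ideal.Quotient.eq_zero_iff_mem.1 h)
    obtain ⟨c, hc⟩ := hspan _ ⟨hps, mk_mem_component hp⟩
    refine apply_ne_zero_of_smul_eq hc hg hpI' ?_
    have := apply_eq_zero_of_mem_annIdeal hpF
    rwa [hF, homogeneousComponent_self hp] at this

theorem exists_isGorensteinDecomposition [FiniteDimensional k (Poly3 k ⧸ I)] (hI : IsHomog I)
    (hgrade : grade I = 3) {s t N : ℕ} (hN : irrel k ^ N ≤ I)
    (hsoc : ∀ n, socleDim I n = if n = s ∨ n = t then 1 else 0) :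
    ∃ I₁ I₂, IsGorensteinDecomposition s t I I₁ I₂ := by
  obtain ⟨F₁, hF₁, hF₁0, hI₁, h₁⟩ := exists_socle_functional hI (n := s) (by simp [hsoc])
  obtain ⟨F₂, hF₂, hF₂0, hI₂, h₂⟩ := exists_socle_functional hI (n := t) (by simp [hsoc])
  refine ⟨annIdeal F₁, annIdeal F₂, le_antisymm (le_inf hI₁ hI₂) ?_,
    hF₁.isGorenstein3 hF₁0 hI₁ hgrade, hF₁.isTopSocleDegree hF₁0,
    hF₂.isGorenstein3 hF₂0 hI₂ hgrade, hF₂.isTopSocleDegree hF₂0⟩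
  rintro p ⟨hp₁, hp₂⟩
  by_contra hpI
  obtain ⟨q, hq, hqs⟩ := exists_mul_mem_socle hN hpI
  -- Each component of the socle element `p * q` lies in `I`: in degrees `s` and `t` the functionals
  -- detect it, elsewhere the socle vanishes.
  refine hq (mem_of_homogeneousComponent_mem fun n => ?_)
  have hs := hI.homogeneousComponent_mem_socle hqs n
  have hc := homogeneousComponent_isHomogeneous n (p * q)
  by_cases hns : n = s
  · subst hns
    exact h₁ _ hc hs (hF₁.isHomog.homogeneousComponent_mem (Ideal.mul_mem_right q _ hp₁) n)
  by_cases hnt : n = t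
  · subst hnt
    exact h₂ _ hc hs (hF₂.isHomog.homogeneousComponent_mem (Ideal.mul_mem_right q _ hp₂) n)
  have h0 := hsoc n
  rw [if_neg (by tauto), socleDim, Submodule.finrank_eq_zero] at h0
  have := (Submodule.eq_bot_iff _).1 h0 _ ⟨hs, mk_mem_component hc⟩
  exact Ideal.Quotient.eq_zero_iff_mem.1 this

end Decomposition

/-! ### The numerical consequence of compressedness. -/

section Compressed

variable {I : Ideal (Poly3 k)} {s t : ℕ}

theorem isTopSocleDegree_eq [FiniteDimensional k (Poly3 k ⧸ I)] (hs : 2 ≤ s)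
    (hsoc : ∀ n : ℕ, socleDim I n = if n = s ∨ n = 2 * s - 1 then 1 else 0)
    (ht : IsTopSocleDegree I t) : t = 2 * s - 1 := by
  have h1 : t = s ∨ t = 2 * s - 1 := by
    by_contra h
    obtain ⟨p, hp, hpI⟩ := ht.exists_isHomogeneous
    have h0 := hsoc t
    rw [if_neg h, socleDim, Submodule.finrank_eq_zero] at h0
    refine hpI (Ideal.Quotient.eq_zero_iff_mem.1 ((Submodule.eq_bot_iff _).1 h0 _
      ⟨mk_mem_socle.2 fun i => ?_, mk_mem_component hp⟩))
    exact ht.mem_of_isHomogeneous (Nat.lt_succ_self t) (hp.mul (isHomogeneous_X k i))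
  have h2 : 2 * s - 1 ≤ t := by
    have h0 := hsoc (2 * s - 1)
    rw [if_pos (Or.inr rfl), socleDim] at h0
    obtain ⟨σ, ⟨-, hσ⟩, hσ0, -⟩ := exists_generator_of_finrank_eq_one h0
    obtain ⟨p, hp, rfl⟩ := mem_component.1 hσ
    by_contra! h
    exact hσ0 (Ideal.Quotient.eq_zero_iff_mem.2 (ht.mem_of_isHomogeneous h hp))
  omega

theorem two_add_succ_choose (n : ℕ) : (2 + (n + 1)).choose (n + 1) = (2 + n).choose n + (n + 2) := by
  have h1 : (2 + (n + 1)).choose (n + 1) = (2 + n).choose n + (2 + n).choose (n + 1) :=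
    Nat.choose_succ_succ (2 + n) n
  have h2 : (2 + n).choose (n + 1) = n + 2 := by
    rw [add_comm 2 n]
    exact Nat.choose_succ_self_right (n + 1)
  rw [h1, h2]

/-- In degree `s` the socle bound `1 + C(s+1, 2)` is at most `dim R_s = C(s+1, 2) + s + 1`, so it is
the minimum, and the difference is `s`. -/
theorem finrank_gradedPart_of_isCompressed (hs : 2 ≤ s) (hhom : IsHomog I) (hcomp : IsCompressed I)
    (hemb : embDim I = 3)
    (hsoc : ∀ n : ℕ, socleDim I n = if n = s ∨ n = 2 * s - 1 then 1 else 0) :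
    Module.finrank k (gradedPart I s) = s := by
  obtain ⟨hfin, t, ht, hh⟩ := hcomp
  obtain rfl := isTopSocleDegree_eq hs hsoc ht
  obtain ⟨m, rfl⟩ : ∃ m, s = m + 1 := ⟨s - 1, by omega⟩
  have h := hh (m + 1) (by omega)
  have hsum : ∑ l ∈ Finset.Icc (m + 1) (2 * (m + 1) - 1),
      socleCoeff I l * (embDim I - 1 + (l - (m + 1))).choose (l - (m + 1)) =
        1 + (2 + m).choose m := by
    rw [Finset.sum_eq_add_of_mem (m + 1) (2 * (m + 1) - 1) (by simp; omega) (by simp; omega) (by omega)]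
    · have e : 2 * (m + 1) - 1 - (m + 1) = m := by omega
      simp [hhom.socleCoeff_eq, hsoc, hemb, e]
    · intro l _ hl
      rw [hhom.socleCoeff_eq, hsoc, if_neg (by tauto), zero_mul]
  rw [hsum, hhom.hilb_eq, hemb, two_add_succ_choose, min_eq_right (by omega)] at h
  have h1 := finrank_component_add (I := I) (m + 1)
  rw [finrank_homogeneousSubmodule, two_add_succ_choose, h] at h1
  change _ + Module.finrank k (gradedPart I (m + 1)) = _ at h1
  omega

end Compressed

/-! ### Initial degree and generators of the second component. -/

section Trimming

variable {I J J₁ : Ideal (Poly3 k)} {s : ℕ}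

theorem gradedPart_eq_bot_of_le {m n : ℕ} (h : gradedPart J n = ⊥) (hmn : m ≤ n) :
    gradedPart J m = ⊥ := by
  rw [Submodule.eq_bot_iff] at h ⊢
  rintro p ⟨hp, hp'⟩
  have h1 : X 0 ^ (n - m) * p = 0 := by
    refine h _ ⟨J.mul_mem_left _ hp, ?_⟩
    have := (isHomogeneous_X_pow (R := k) (0 : Fin 3) (n - m)).mul hp'
    rwa [Nat.sub_add_cancel hmn] at this
  exact (mul_eq_zero.1 h1).resolve_left (pow_ne_zero _ (X_ne_zero _))

theorem IsGorensteinDecomposition.gradedPart_eq (h : IsGorensteinDecomposition s (2 * s - 1) I J₁ J)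
    {n : ℕ} (hn : s < n) : gradedPart J n = gradedPart I n := by
  obtain ⟨rfl, -, h₁, -⟩ := h
  ext p
  exact ⟨fun hp => ⟨⟨h₁.mem_of_isHomogeneous hn hp.2, hp.1⟩, hp.2⟩, fun hp => ⟨hp.1.2, hp.2⟩⟩

/-- The initial degree of the second component of a decomposition. -/
theorem IsGorensteinDecomposition.finrank_gradedPart (hs : 2 ≤ s)
    (h : IsGorensteinDecomposition s (2 * s - 1) I J₁ J)
    (hI : Module.finrank k (gradedPart I s) = s) :
    gradedPart J (s - 1) = ⊥ ∧ Module.finrank k (gradedPart J s) = s + 1 := by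
  obtain ⟨rfl, hJ₁, h₁, hJ, h₂⟩ := h
  obtain ⟨m, rfl⟩ : ∃ m, s = m + 1 := ⟨s - 1, by omega⟩
  obtain ⟨f₁, hf₁⟩ := exists_isDualizing hJ₁ h₁
  obtain ⟨f, hf⟩ := exists_isDualizing hJ h₂
  have := hJ₁.2.2.1
  have := hJ.2.2.1
  have e1 := hf₁.finrank_component_eq (m := m + 1) (n := 0) (by omega)
  have e2 := hf.finrank_component_eq (m := m + 1) (n := m) (by omega)
  have c0 := finrank_component_add (I := J₁) 0
  have c1 := finrank_component_add (I := J₁) (m + 1)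
  have c2 := finrank_component_add (I := J) (m + 1)
  have c3 := finrank_component_add (I := J) m
  change _ + Module.finrank k (gradedPart J₁ (m + 1)) = _ at c1
  change _ + Module.finrank k (gradedPart J (m + 1)) = _ at c2
  change _ + Module.finrank k (gradedPart J m) = _ at c3
  rw [finrank_homogeneousSubmodule] at c0 c1 c2 c3
  rw [two_add_succ_choose] at c1 c2
  -- Upper bound: `J₁` has codimension at most one in degree `s = m + 1` by `e1` and `c0`, so `dim
  -- J_s ≤ dim I_s + 1`. The lower bound comes from `e2` and `c3`, and comparing the two gives `J_m
  -- = 0`.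
  have hsup := Submodule.finrank_sup_add_finrank_inf_eq (gradedPart J₁ (m + 1))
    (gradedPart J (m + 1))
  have hinf : gradedPart J₁ (m + 1) ⊓ gradedPart J (m + 1) = gradedPart (J₁ ⊓ J) (m + 1) := by
    ext p
    exact ⟨fun hp => ⟨⟨hp.1.1, hp.2.1⟩, hp.1.2⟩, fun hp => ⟨⟨hp.1.1, hp.2⟩, ⟨hp.1.2, hp.2⟩⟩⟩
  have hle := Submodule.finrank_mono
    (sup_le inf_le_right inf_le_right : gradedPart J₁ (m + 1) ⊔ gradedPart J (m + 1) ≤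
      homogeneousSubmodule (Fin 3) k (m + 1))
  rw [finrank_homogeneousSubmodule, two_add_succ_choose] at hle
  rw [hinf, hI] at hsup
  rw [Nat.choose_zero_right] at c0
  rw [← Submodule.finrank_eq_zero, Nat.add_sub_cancel]
  omega

/-- No new generators appear in degree `n + 1 > s + 1`: they are counted by `Tor_1`, which is dual
to a `Tor_2` governed by `J` in degree `2s - n ≤ s - 1`. Past the socle degree `J` is everything. -/
theorem IsDualizing.gradedPart_succ_le {f : (Poly3 k ⧸ J) →ₗ[k] k} (hf : IsDualizing J (2 * s - 1) f)
    (hhom : IsHomog J) (htop : IsTopSocleDegree J (2 * s - 1))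
    [FiniteDimensional k (Poly3 k ⧸ J)] (hJ : gradedPart J (s - 1) = ⊥) {n : ℕ} (hn : s < n) :
    gradedPart J (n + 1) ≤ varsMul J n := by
  by_cases h : n ≤ 2 * s - 1
  · apply le_of_relDim_eq_zero
    rw [← hhom.torDimOne_eq, hf.torDimOne_eq_torDimTwo (n := 2 * s - 1 - n) (by omega)]
    exact torDimTwo_eq_zero (gradedPart_eq_bot_of_le hJ (by omega))
  · rintro p ⟨-, hp⟩
    obtain ⟨q, hq, rfl⟩ := IsHomogeneous.exists_sum_X hp
    exact mem_varsMul.2 ⟨q, fun i => ⟨htop.mem_of_isHomogeneous (by omega) (hq i), hq i⟩, rfl⟩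

/-- A generator of degree `s` contributes to degree `s` through the constant term of its coefficient
and to degree `s + 1` through the linear part. Irredundancy thus becomes linear algebra in these two
degrees. -/
theorem mem_span_union_components {S₁ S₂ : Set (Poly3 k)} (h₁ : S₁ ⊆ gradedPart J s)
    (h₂ : S₂ ⊆ gradedPart J (s + 1)) {p : Poly3 k} (hp : p ∈ Ideal.span (S₁ ∪ S₂)) :
    homogeneousComponent s p ∈ Submodule.span k S₁ ∧
      homogeneousComponent (s + 1) p ∈ varsMul J s ⊔ Submodule.span k S₂ := by
  refine Submodule.closure_induction ⟨by simp, by simp⟩ (fun p q _ _ hp hq => ?_)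
    (fun r g hg => ?_) hp
  · rw [map_add, map_add]
    exact ⟨add_mem hp.1 hq.1, add_mem hp.2 hq.2⟩
  · rw [smul_eq_mul]
    rcases hg with hg | hg
    · constructor
      · have := homogeneousComponent_add_mul (h₁ hg).2 r 0
        rw [zero_add, homogeneousComponent_zero, ← smul_eq_C_mul] at this
        rw [this]
        exact Submodule.smul_mem _ _ (Submodule.subset_span hg)
      · refine Submodule.mem_sup_left (mem_varsMul.2 ?_)
        obtain ⟨q, hq, hq'⟩ := IsHomogeneous.exists_sum_X (n := 0)
          (homogeneousComponent_isHomogeneous 1 r)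
        refine ⟨fun i => q i * g, fun i => ⟨J.mul_mem_left _ (h₁ hg).1, ?_⟩, ?_⟩
        · simpa using (hq i).mul (h₁ hg).2
        · rw [add_comm, homogeneousComponent_add_mul (h₁ hg).2, hq', Finset.sum_mul]
          exact Finset.sum_congr rfl fun i _ => (mul_assoc _ _ _).symm
    · constructor
      · rw [homogeneousComponent_mul_of_lt (h₂ hg).2 r (Nat.lt_succ_self s)]
        exact zero_mem _
      · have := homogeneousComponent_add_mul (h₂ hg).2 r 0
        rw [zero_add, homogeneousComponent_zero, ← smul_eq_C_mul] at this
        rw [this]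
        exact Submodule.mem_sup_right (Submodule.smul_mem _ _ (Submodule.subset_span hg))

theorem IsHomog.le_of_gradedPart_le (hJ : IsHomog J) {T : Ideal (Poly3 k)}
    (h : ∀ n, gradedPart J n ≤ T.restrictScalars k) : J ≤ T := fun p hp =>
  mem_of_homogeneousComponent_mem fun n =>
    h n ⟨hJ.homogeneousComponent_mem hp n, homogeneousComponent_isHomogeneous n p⟩

theorem varsMul_le_restrictScalars {T : Ideal (Poly3 k)} {n : ℕ}
    (h : gradedPart J n ≤ T.restrictScalars k) : varsMul J n ≤ T.restrictScalars k := by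
  intro p hp
  obtain ⟨u, hu, rfl⟩ := mem_varsMul.1 hp
  exact sum_mem fun i _ => T.mul_mem_left _ (h (hu i))

theorem span_le_restrictScalars {S : Set (Poly3 k)} {T : Ideal (Poly3 k)} (h : S ⊆ T) :
    Submodule.span k S ≤ T.restrictScalars k :=
  Submodule.span_le.2 h

/-- An ideal generated in degrees `s` and `s + 1` is generated by a basis in degree `s` and by lifts
of a basis in degree `s + 1`, and these generators are irredundant. -/
theorem isMinimalGeneratingFamily_sum {ι κ : Type*} (hhom : IsHomog J)
    (hlow : ∀ n < s, gradedPart J n = ⊥)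
    (hgen : ∀ n, s < n → gradedPart J (n + 1) ≤ varsMul J n)
    {φ : ι → Poly3 k} {ψ : κ → Poly3 k}
    (hφJ : ∀ i, φ i ∈ gradedPart J s) (hψJ : ∀ j, ψ j ∈ gradedPart J (s + 1))
    (hφ : gradedPart J s ≤ Submodule.span k (Set.range φ))
    (hψ : gradedPart J (s + 1) ≤ varsMul J s ⊔ Submodule.span k (Set.range ψ))
    (hφ' : ∀ i, φ i ∉ Submodule.span k (φ '' {i}ᶜ))
    (hψ' : ∀ j, ψ j ∉ varsMul J s ⊔ Submodule.span k (ψ '' {j}ᶜ)) :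
    IsMinimalGeneratingFamily J (Sum.elim φ ψ) := by
  have hmem : ∀ i, Sum.elim φ ψ i ∈ J := by
    rintro (i | j)
    exacts [(hφJ i).1, (hψJ j).1]
  refine ⟨le_antisymm (Ideal.span_le.2 (Set.range_subset_iff.2 hmem)) ?_, ?_⟩
  · set T := Ideal.span (Set.range (Sum.elim φ ψ))
    have hs : gradedPart J s ≤ T.restrictScalars k := hφ.trans (span_le_restrictScalars
      (Set.range_subset_iff.2 fun i => Ideal.subset_span ⟨Sum.inl i, rfl⟩))
    refine hhom.le_of_gradedPart_le fun n => ?_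
    rcases lt_trichotomy n s with h | rfl | h
    · rw [hlow n h]
      exact bot_le
    · exact hs
    · induction n, h using Nat.le_induction with
      | base =>
        exact hψ.trans (sup_le (varsMul_le_restrictScalars hs) (span_le_restrictScalars
          (Set.range_subset_iff.2 fun j => Ideal.subset_span ⟨Sum.inr j, rfl⟩)))
      | succ n hn ih => exact (hgen n hn).trans (varsMul_le_restrictScalars ih)
  · rintro (i | j) heq
    · have hle : Sum.elim φ ψ '' {Sum.inl i}ᶜ ⊆ φ '' {i}ᶜ ∪ Set.range ψ := by
        rintro _ ⟨i' | j', h, rfl⟩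
        · exact Or.inl ⟨i', fun h' => h (congrArg Sum.inl h'), rfl⟩
        · exact Or.inr ⟨j', rfl⟩
      have h := (mem_span_union_components (s := s) (J := J)
        (Set.image_subset_iff.2 fun i _ => hφJ i) (Set.range_subset_iff.2 hψJ)
        (Ideal.span_mono hle (heq ▸ (hφJ i).1))).1
      rw [homogeneousComponent_self (hφJ i).2] at h
      exact hφ' i h
    · have hle : Sum.elim φ ψ '' {Sum.inr j}ᶜ ⊆ Set.range φ ∪ ψ '' {j}ᶜ := by
        rintro _ ⟨i' | j', h, rfl⟩
        · exact Or.inl ⟨i', rfl⟩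
        · exact Or.inr ⟨j', fun h' => h (congrArg Sum.inr h'), rfl⟩
      have h := (mem_span_union_components (s := s) (J := J)
        (Set.range_subset_iff.2 hφJ) (Set.image_subset_iff.2 fun j _ => hψJ j)
        (Ideal.span_mono hle (heq ▸ (hψJ j).1))).2
      rw [homogeneousComponent_self (hψJ j).2] at h
      exact hψ' j h

/-- A basis of a subspace of codimension one, extended to a basis of the whole space. -/
theorem exists_basis_snoc {M : Type*} [AddCommGroup M] [Module k M] {U V : Submodule k M}
    [FiniteDimensional k U] [FiniteDimensional k V] (hUV : U ≤ V) {n : ℕ}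
    (hU : Module.finrank k U = n) (hV : Module.finrank k V = n + 1) :
    ∃ φ : Fin (n + 1) → M, LinearIndependent k φ ∧
      Submodule.span k (Set.range fun i : Fin n => φ i.castSucc) = U ∧
      Submodule.span k (Set.range φ) = V ∧ φ (Fin.last n) ∉ U := by
  let e := Module.finBasisOfFinrankEq k U hU
  have hrange : Submodule.span k (Set.range fun i => (e i : M)) = U := by
    have := congrArg (Submodule.map U.subtype) e.span_eq
    rwa [Submodule.map_span, ← Set.range_comp, Submodule.map_top, Submodule.range_subtype] at this
  obtain ⟨v, hv, hvU⟩ : ∃ v ∈ V, v ∉ U := by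
    by_contra! h
    have := Submodule.finrank_mono (show V ≤ U from h)
    omega
  have hli : LinearIndependent k (Fin.snoc (fun i => (e i : M)) v : Fin (n + 1) → M) := by
    rw [linearIndependent_finSnoc, hrange]
    exact ⟨e.linearIndependent.map' U.subtype U.ker_subtype, hvU⟩
  refine ⟨_, hli, by simpa using hrange, ?_, by simpa using hvU⟩
  refine Submodule.eq_of_le_of_finrank_eq ?_ ?_
  · rw [Submodule.span_le, Set.range_subset_iff]
    intro i
    refine Fin.lastCases ?_ (fun i => ?_) i
    · simpa using hv
    · simpa using hUV (e i).2
  · rw [finrank_span_eq_card hli, hV, Fintype.card_fin]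

end Trimming

end TrimmedGorenstein

end

/-! ### Assembly of the theorem. -/

open TrimmedGorenstein in
theorem mainTheorem2 {k : Type*} [Field k] (s : ℕ) (hs : 3 ≤ s)
    (I : Ideal (TrimmedGorenstein.Poly3 k))
    (hhom : TrimmedGorenstein.IsHomog I)
    (hgrade : TrimmedGorenstein.grade I = 3)
    (hcomp : TrimmedGorenstein.IsCompressed I)
    (hemb : TrimmedGorenstein.embDim I = 3)
    (hsoc : ∀ n : ℕ, TrimmedGorenstein.socleDim I n = if n = s ∨ n = 2 * s - 1 then 1 else 0) :
    (∃ I₁ I₂ : Ideal (TrimmedGorenstein.Poly3 k),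
      TrimmedGorenstein.IsGorensteinDecomposition s (2 * s - 1) I I₁ I₂) ∧
    ∀ I₁ I₂ : Ideal (TrimmedGorenstein.Poly3 k),
      TrimmedGorenstein.IsGorensteinDecomposition s (2 * s - 1) I I₁ I₂ →
      ∃ (b : ℕ) (φ : Fin (s + 1) → TrimmedGorenstein.Poly3 k)
        (ψ : Fin b → TrimmedGorenstein.Poly3 k),
        (∀ i, (φ i).IsHomogeneous s) ∧
        (∀ j, (ψ j).IsHomogeneous (s + 1)) ∧
        TrimmedGorenstein.IsMinimalGeneratingFamily I₂ (Sum.elim φ ψ) ∧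
        I = Ideal.span (Set.range (fun i : Fin s => φ i.castSucc) ∪ Set.range ψ) ⊔
          TrimmedGorenstein.irrel k * Ideal.span {φ (Fin.last s)} ∧
        b = TrimmedGorenstein.torDimOne I₂ s ∧
        b = TrimmedGorenstein.torDimTwo I₂ (s - 1) := by
  have hfin := hcomp.1
  have hIs := finrank_gradedPart_of_isCompressed (by omega) hhom hcomp hemb hsoc
  obtain ⟨-, t, ht, -⟩ := hcomp
  refine ⟨exists_isGorensteinDecomposition hhom hgrade ht.irrel_pow_le hsoc, ?_⟩
  intro I₁ J h
  obtain ⟨hJlow, hJs⟩ := h.finrank_gradedPart (by omega) hIs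
  have hgt := fun n (hn : s < n) => h.gradedPart_eq hn
  have hIJ : I ≤ J := h.1 ▸ inf_le_right
  obtain ⟨-, -, -, hJ, htop⟩ := h
  have hJhom := hJ.1
  have := hJ.2.2.1
  obtain ⟨f, hf⟩ := exists_isDualizing hJ htop
  have htor := hf.torDimOne_eq_torDimTwo (m := s) (n := s - 1) (by omega)
  obtain ⟨φ, hli, hφI, hφJ, hlast⟩ := exists_basis_snoc
    (show gradedPart I s ≤ gradedPart J s from fun p hp => ⟨hIJ hp.1, hp.2⟩) hIs hJs
  obtain ⟨ψ, hψJ, hψ, hψ'⟩ := exists_basis_mod (gradedPart J (s + 1)) (varsMul J s)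
  have hφmem : ∀ i, φ i ∈ gradedPart J s := fun i => hφJ ▸ Submodule.subset_span ⟨i, rfl⟩
  have hmin : IsMinimalGeneratingFamily J (Sum.elim φ ψ) :=
    isMinimalGeneratingFamily_sum hJhom
      (fun n hn => gradedPart_eq_bot_of_le hJlow (by omega))
      (fun n hn => hf.gradedPart_succ_le hJhom htop hJlow hn) hφmem hψJ hφJ.ge hψ
      (fun i => hli.notMem_span_image (by simp)) hψ'
  refine ⟨_, φ, ψ, fun i => (hφmem i).2, fun j => (hψJ j).2, hmin, ?_, ?_, ?_⟩
  · have hle : Ideal.span (Set.range (fun i : Fin s => φ i.castSucc) ∪ Set.range ψ) ⊔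
        irrel k * Ideal.span {φ (Fin.last s)} ≤ I := by
      refine sup_le (Ideal.span_le.2 (Set.union_subset (Set.range_subset_iff.2 fun i => ?_)
        (Set.range_subset_iff.2 fun j => ?_))) ?_
      · have : φ i.castSucc ∈ gradedPart I s := hφI ▸ Submodule.subset_span ⟨i, rfl⟩
        exact this.1
      · have := hψJ j
        rw [hgt _ (Nat.lt_succ_self s)] at this
        exact this.1
      · rw [irrel, idealOfVars, Ideal.span_mul_span', Ideal.span_le, Set.mul_subset_iff]
        rintro _ ⟨i, rfl⟩ _ rfl
        -- Multiplication by a variable moves `φ_(s+1)` into degree `s + 1`, where `I` and `J`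
        -- coincide.
        have : X i * φ (Fin.last s) ∈ gradedPart J (s + 1) :=
          varsMul_le s (mem_varsMul.2 ⟨Pi.single i (φ (Fin.last s)), fun j => by
            by_cases hj : j = i
            · subst hj; simpa using hφmem _
            · simp [hj], by simp [Pi.single_apply]⟩)
        rw [hgt _ (Nat.lt_succ_self s)] at this
        exact this.1
    refine le_antisymm (fun p hp => ?_) hle
    set T := Ideal.span (Set.range (fun i : Fin s => φ i.castSucc) ∪ Set.range ψ)
    have hsplit : J ≤ T ⊔ Ideal.span {φ (Fin.last s)} := by
      rw [← hmin.1, Ideal.span_le, Set.range_subset_iff]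
      rintro (i | j)
      · refine Fin.lastCases ?_ (fun i => ?_) i
        · exact Ideal.mem_sup_right (Ideal.mem_span_singleton_self _)
        · exact Ideal.mem_sup_left (Ideal.subset_span (Or.inl ⟨i, rfl⟩))
      · exact Ideal.mem_sup_left (Ideal.subset_span (Or.inr ⟨j, rfl⟩))
    obtain ⟨r, hr, q, hq, rfl⟩ := Submodule.mem_sup.1 (hsplit (hIJ hp))
    obtain ⟨c, rfl⟩ := Ideal.mem_span_singleton'.1 hq
    have hc1 : (c - C (coeff 0 c)) * φ (Fin.last s) ∈ irrel k * Ideal.span {φ (Fin.last s)} :=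
      Ideal.mul_mem_mul (sub_C_mem_irrel c) (Ideal.mem_span_singleton_self _)
    -- Everything in `r + c φ_(s+1)` except the constant term of `c` is known to give an element of
    -- `I`. That constant must vanish, since `φ_(s+1)` is not in `I`.
    have hc2 : coeff 0 c • φ (Fin.last s) ∈ I := by
      have h1 := I.sub_mem hp (hle (Submodule.add_mem_sup hr hc1))
      rw [smul_eq_C_mul]
      convert h1 using 1
      ring
    have hc0 : coeff 0 c = 0 := by
      by_contra h0
      refine hlast ⟨?_, (hφmem _).2⟩
      exact ((I.restrictScalars k).smul_mem_iff h0).1 hc2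
    rw [hc0, map_zero, sub_zero] at hc1
    exact Submodule.add_mem_sup hr hc1
  · exact (hJhom.torDimOne_eq s).symm
  · exact (hJhom.torDimOne_eq s).symm.trans htor
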